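/- Let $k$ be a field of characteristic $0$ and $A=k\langle x,y,z\rangle/(x^2+yx,\;xz,\;zy)$. Let $HH_0(A)=A/\operatorname{im} d_1$ and $HH_1(A)=\ker d_1/\operatorname{im} d_2$ be computed by the reduced Hochschild complex $C_n=A\otimes\bar A^{\otimes n}$, $\bar A=A/k\cdot 1$, with $d_1(a\otimes b)=ab-ba$ and $d_2(a\otimes b\otimes c)=ab\otimes c-a\otimes bc+ca\otimes b$. Connes' differential $b_0:HH_0(A)\to HH_1(A)$ is induced by $a\mapsto 1\otimes a$. Let $V_1=k\{x,y,z\}$, $V_2=k\{x^2+yx,\,xz,\,zy\}\subset V_1\otimes V_1$, and consider the Koszul complex $A\otimes V_2\to A\otimes V_1\to A$ (in degrees $2,1,0$), with $d_1(a\otimes p)=ap-pa$ for $p\in\{x,y,z\}$, and $$d_2(a\otimes(x^2+yx))=(a(x+y)+xa)\otimes x+xa\otimes y,\quad d_2(a\otimes xz)=ax\otimes z+za\otimes x,\quad d_2(a\otimes zy)=az\otimes y+ya\otimes z.$$ The maps $\mathrm{id}:A\to A$ and $a\otimes p\mapsto a\otimes p$, $A\otimes V_1\to A\otimes\bar A$,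 induce isomorphisms from the homology of the Koszul complex in degrees $0$ and $1$ to $HH_0(A)$ and $HH_1(A)$. Through them, write the following classes, where all parameters $n,m,p,n_i,m_i$ are integers $\ge 1$. In $HH_0(A)$: $\zeta_0=1$, $\alpha_0=x$, $\beta_0(n)=y^nx$, $\gamma_0(n)=y^n$, $\delta_0(m)=z^m$, and $$\bar\epsilon_0(n_1,\dots,n_p;m_1,\dots,m_p)=y^{n_1}z^{m_1}x\,y^{n_2}z^{m_2}x\cdots y^{n_p}z^{m_p}x,$$ which depends on the sequence of pairs $(n_i,m_i)$ only up to cyclic permutation. These elements (one $\bar\epsilon_0$ for each nonempty cyclic sequence of pairs) form a $k$-basis of $HH_0(A)$. In $HH_1(A)$: $\alpha_1=1\otimes x$, $\beta_1=x\otimes x$, $\gamma_1(n)=y^nx\otimes x$, $\delta_1=1\otimes y$, $\epsilon_1(n)=y^n\otimes y$, $\zeta_1=1\otimes z$, $\eta_1(m)=z^m\otimes z$, and $$\theta_1(n_1,\dots,n_p;m_1,\dots,m_p)=\sum_{i=1}^p\Big(y^{n_i}z^{m_i}P_i\otimes x+\sum_{t=1}^{n_i}y^{n_i-t}z^{m_i}P_i\,x\,y^{t-1}\otimes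 y+\sum_{s=1}^{m_i}z^{m_i-s}P_i\,x\,y^{n_i}z^{s-1}\otimes z\Big),$$ where $P_i=\prod_{j=i+1}^{i+p-1}xy^{n_j}z^{m_j}$ (ordered product, indices modulo $p$, so $P_1=1$ if $p=1$). Then Connes' differential is given by 1. $b_0(\alpha_0)=\alpha_1$; 2. $b_0(\beta_0(n))=-(n+1)\,\gamma_1(n-1)$ for $n\ge2$, and $b_0(\beta_0(1))=-2\beta_1$; 3. $b_0(\gamma_0(n))=n\,\epsilon_1(n-1)$ for $n\ge2$, and $b_0(\gamma_0(1))=\delta_1$; 4. $b_0(\delta_0(m))=m\,\eta_1(m-1)$ for $m\ge2$, and $b_0(\delta_0(1))=\zeta_1$; 5. $b_0(\bar\epsilon_0(n_1,\dots,n_p;m_1,\dots,m_p))=\theta_1(n_1,\dots,n_p;m_1,\dots,m_p)$ for all $p\ge1$ and $n_i,m_i\ge1$; 6. $b_0(\zeta_0)=0$. -/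

import Mathlib

open scoped TensorProduct

noncomputable section

namespace HochConnes

/-! ## Hochschild homology in degrees 0 and 1, and Connes' differential -/

section Hochschild

variable (k : Type*) [Field k] (R : Type*) [Ring R] [Algebra k R]

/-- The reduced space `R̄ = R / k·1`. -/
def Bar : Type _ := R ⧸ Submodule.span k {(1 : R)}

instance : AddCommGroup (Bar k R) :=
  inferInstanceAs (AddCommGroup (R ⧸ Submodule.span k {(1 : R)}))

instance : Module k (Bar k R) :=
  inferInstanceAs (Module k (R ⧸ Submodule.span k {(1 : R)}))

/-- The projection `R → R / k·1`. -/
def bar : R →ₗ[k] Bar k R := (Submodule.span k {(1 : R)}).mkQ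

lemma bar_one : bar k R 1 = 0 :=
  (Submodule.Quotient.mk_eq_zero _).2 (Submodule.subset_span rfl)

lemma bar_surjective : Function.Surjective (bar k R) := Submodule.mkQ_surjective _

/-- A linear map on `R` that vanishes at `1` induces a linear map on `R̄`. -/
def barLift {M : Type*} [AddCommGroup M] [Module k M] (f : R →ₗ[k] M) (hf : f 1 = 0) :
    Bar k R →ₗ[k] M :=
  (Submodule.span k {(1 : R)}).liftQ f (by
    rw [Submodule.span_le, Set.singleton_subset_iff]
    exact hf)

lemma barLift_bar {M : Type*} [AddCommGroup M] [Module k M] (f : R →ₗ[k] M) (hf : f 1 = 0)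
    (a : R) : barLift k R f hf (bar k R a) = f a := rfl

/-- The reduced Hochschild chains `C₁ = R ⊗ R̄`; in degree `0` they are `C₀ = R`. -/
def C1 : Type _ := R ⊗[k] Bar k R

instance : AddCommGroup (C1 k R) := inferInstanceAs (AddCommGroup (R ⊗[k] Bar k R))

instance : Module k (C1 k R) := inferInstanceAs (Module k (R ⊗[k] Bar k R))

/-- The reduced Hochschild chains `C₂ = R ⊗ (R̄ ⊗ R̄)`. -/
def C2 : Type _ := R ⊗[k] (Bar k R ⊗[k] Bar k R)

instance : AddCommGroup (C2 k R) :=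
  inferInstanceAs (AddCommGroup (R ⊗[k] (Bar k R ⊗[k] Bar k R)))

instance : Module k (C2 k R) := inferInstanceAs (Module k (R ⊗[k] (Bar k R ⊗[k] Bar k R)))

/-- The chain `a₀ ⊗ a₁`, where only the image of `a₁` in `R̄` matters. -/
def chain1 : R →ₗ[k] R →ₗ[k] C1 k R :=
  (TensorProduct.mk k R (Bar k R)).compl₂ (bar k R)

/-- The chain `a₀ ⊗ a₁ ⊗ a₂`, where only the images of `a₁, a₂` in `R̄` matter. -/
def chain2 (a b c : R) : C2 k R :=
  (a ⊗ₜ[k] (bar k R b ⊗ₜ[k] bar k R c) : R ⊗[k] (Bar k R ⊗[k] Bar k R))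

lemma chain1_one (a : R) : chain1 k R a 1 = 0 := by
  change a ⊗ₜ[k] bar k R 1 = 0
  rw [bar_one, TensorProduct.tmul_zero]

lemma C1_induction {p : C1 k R → Prop} (h0 : p 0) (ht : ∀ a b, p (chain1 k R a b))
    (ha : ∀ u v, p u → p v → p (u + v)) (u : C1 k R) : p u := by
  refine TensorProduct.induction_on (motive := p) u h0 (fun a c => ?_) ha
  obtain ⟨b, rfl⟩ := bar_surjective k R c
  exact ht a b

/-- The Hochschild differential `d₁ : C₁ → C₀`, `a₀ ⊗ a₁ ↦ a₀ a₁ - a₁ a₀`. -/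
def hochD1 : C1 k R →ₗ[k] R :=
  TensorProduct.lift
    (barLift k R ((LinearMap.mul k R).flip - LinearMap.mul k R) (by ext a; simp)).flip

lemma hochD1_chain1 (a b : R) : hochD1 k R (chain1 k R a b) = a * b - b * a := rfl

/-- `(a₁, a₂, a₀) ↦ a₀ a₁ ⊗ a₂ - a₀ ⊗ a₁ a₂ + a₂ a₀ ⊗ a₁`, as a trilinear map on `R`. -/
def preD2 : R →ₗ[k] R →ₗ[k] R →ₗ[k] C1 k R :=
  LinearMap.mk₂ k
    (fun b c =>
      (chain1 k R).flip c ∘ₗ LinearMap.mulRight k b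
        - (chain1 k R).flip (b * c)
        + (chain1 k R).flip b ∘ₗ LinearMap.mulLeft k c)
    (by intro b b' c; ext a; simp [mul_add, add_mul]; abel)
    (by intro r b c; ext a; simp [smul_sub, smul_add])
    (by intro b c c'; ext a; simp [mul_add, add_mul]; abel)
    (by intro r b c; ext a; simp [smul_sub, smul_add])

lemma preD2_apply (a b c : R) :
    preD2 k R b c a
      = chain1 k R (a * b) c - chain1 k R a (b * c) + chain1 k R (c * a) b := by
  simp [preD2]

/-- The Hochschild differential `d₂ : C₂ → C₁`,
`a₀ ⊗ a₁ ⊗ a₂ ↦ a₀ a₁ ⊗ a₂ - a₀ ⊗ a₁ a₂ + a₂ a₀ ⊗ a₁`. -/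
def hochD2 : C2 k R →ₗ[k] C1 k R :=
  TensorProduct.lift
    (TensorProduct.lift
      (barLift k R
        (LinearMap.flip (barLift k R (preD2 k R).flip (by
          ext b a
          simp [preD2_apply, chain1_one])))
        (by
          ext c a
          obtain ⟨c, rfl⟩ := bar_surjective k R c
          rw [LinearMap.flip_apply, barLift_bar]
          simp [preD2_apply, chain1_one]))).flip

lemma hochD2_chain2 (a b c : R) :
    hochD2 k R (chain2 k R a b c)
      = chain1 k R (a * b) c - chain1 k R a (b * c) + chain1 k R (c * a) b := by
  rw [← preD2_apply]
  rfl

/-- `HH₀(R) = C₀ / im d₁`. -/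
abbrev HH0 : Type _ := R ⧸ LinearMap.range (hochD1 k R)

/-- `HH₁(R) = ker d₁ / im d₂`. -/
abbrev HH1 : Type _ :=
  LinearMap.ker (hochD1 k R) ⧸
    (LinearMap.range (hochD2 k R)).submoduleOf (LinearMap.ker (hochD1 k R))

/-- Connes' differential on chains in degree `0`: `C₀ → C₁`, `a ↦ 1 ⊗ a`. -/
def connesChain : R →ₗ[k] C1 k R := chain1 k R 1

/-- Connes' differential on chains, with values in the cycles of `C₁`. -/
def connesCycle : R →ₗ[k] LinearMap.ker (hochD1 k R) :=
  (connesChain k R).codRestrict _ (by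
    intro a
    rw [LinearMap.mem_ker, connesChain, hochD1_chain1, one_mul, mul_one, sub_self])

/-- Connes' differential `b₀ : HH₀(R) → HH₁(R)`, induced by `a ↦ 1 ⊗ a`. -/
def connes : HH0 k R →ₗ[k] HH1 k R :=
  Submodule.mapQ _ _ (connesCycle k R) (by
    rintro _ ⟨t, rfl⟩
    rw [Submodule.mem_comap]
    change connesChain k R (hochD1 k R t) ∈ LinearMap.range (hochD2 k R)
    induction t using C1_induction with
    | h0 => simp
    | ha u v hu hv => rw [map_add, map_add]; exact Submodule.add_mem _ hu hv
    | ht a b =>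
      refine ⟨chain2 k R 1 b a - chain2 k R 1 a b, ?_⟩
      rw [map_sub, hochD2_chain2, hochD2_chain2, hochD1_chain1, connesChain, map_sub]
      simp only [one_mul, mul_one]
      abel)

end Hochschild

/-! ## The algebra `A = k⟨x, y, z⟩ / (x² + yx, xz, zy)` -/

/-- The generators of `A`; they also index the basis of `V₁`. -/
inductive Gen
  | x | y | z

/-- The quadratic relations `x² + yx`, `xz`, `zy`, which index the basis of `V₂`. -/
inductive Quad
  | xxyx | xz | zy

section Algebra

variable (k : Type*) [Field k]

/-- The defining relations of `A`. -/
inductive Rels : FreeAlgebra k Gen → FreeAlgebra k Gen → Prop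
  | xxyx : Rels (FreeAlgebra.ι k Gen.x * FreeAlgebra.ι k Gen.x
      + FreeAlgebra.ι k Gen.y * FreeAlgebra.ι k Gen.x) 0
  | xz : Rels (FreeAlgebra.ι k Gen.x * FreeAlgebra.ι k Gen.z) 0
  | zy : Rels (FreeAlgebra.ι k Gen.z * FreeAlgebra.ι k Gen.y) 0

/-- The algebra `A`. -/
def A : Type _ := RingQuot (Rels k)

instance : Ring (A k) := inferInstanceAs (Ring (RingQuot (Rels k)))

instance : Algebra k (A k) := inferInstanceAs (Algebra k (RingQuot (Rels k)))

/-- The quotient map from the free algebra to `A`. -/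
def toA : FreeAlgebra k Gen →ₐ[k] A k := RingQuot.mkAlgHom k (Rels k)

lemma toA_surjective : Function.Surjective (toA k) := RingQuot.mkAlgHom_surjective k (Rels k)

lemma toA_rel {u v : FreeAlgebra k Gen} (h : Rels k u v) : toA k u = toA k v :=
  RingQuot.mkAlgHom_rel k h

/-- The class of a generator in `A`. -/
def gen (g : Gen) : A k := toA k (FreeAlgebra.ι k g)

abbrev x : A k := gen k Gen.x

abbrev y : A k := gen k Gen.y

abbrev z : A k := gen k Gen.z

lemma rel_xx : x k * x k + y k * x k = 0 := by
  have h := toA_rel k Rels.xxyx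
  simpa [gen] using h

lemma rel_xz : x k * z k = 0 := by
  have h := toA_rel k Rels.xz
  simpa [gen] using h

lemma rel_zy : z k * y k = 0 := by
  have h := toA_rel k Rels.zy
  simpa [gen] using h

/-! ## The Koszul complex `A ⊗ V₂ → A ⊗ V₁ → A`

`A ⊗ Vₙ` is modelled as finitely supported functions from the basis of `Vₙ` to `A`, so that `a ⊗ v`
is `Finsupp.single v a`. The terms in degrees at least `3` do not enter homology in degrees `0, 1`. -/

/-- `A ⊗ V₁`. -/
def K1 : Type _ := Gen →₀ A k

instance : AddCommGroup (K1 k) := inferInstanceAs (AddCommGroup (Gen →₀ A k))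

instance : Module k (K1 k) := inferInstanceAs (Module k (Gen →₀ A k))

/-- The chain `a ⊗ p` of `A ⊗ V₁`, for a generator `p`. -/
def kos1 (p : Gen) : A k →ₗ[k] K1 k := Finsupp.lsingle p

lemma K1_induction {P : K1 k → Prop} (h0 : P 0) (hs : ∀ p a, P (kos1 k p a))
    (ha : ∀ u v, P u → P v → P (u + v)) (u : K1 k) : P u :=
  Finsupp.induction_linear (motive := P) u h0 ha hs

/-- `A ⊗ V₂`. -/
def K2 : Type _ := Quad →₀ A k

instance : AddCommGroup (K2 k) := inferInstanceAs (AddCommGroup (Quad →₀ A k))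

instance : Module k (K2 k) := inferInstanceAs (Module k (Quad →₀ A k))

/-- The chain `a ⊗ r` of `A ⊗ V₂`, for a defining relation `r`. -/
def kos2 (r : Quad) : A k →ₗ[k] K2 k := Finsupp.lsingle r

lemma K2_induction {P : K2 k → Prop} (h0 : P 0) (hs : ∀ r a, P (kos2 k r a))
    (ha : ∀ u v, P u → P v → P (u + v)) (u : K2 k) : P u :=
  Finsupp.induction_linear (motive := P) u h0 ha hs

/-- `d₁ (a ⊗ p) = a p - p a`. -/
def kosD1 : K1 k →ₗ[k] A k :=
  Finsupp.lsum k fun p => LinearMap.mulRight k (gen k p) - LinearMap.mulLeft k (gen k p)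

/-- `d₂ (a ⊗ (x² + yx)) = (a (x + y) + x a) ⊗ x + x a ⊗ y`,
`d₂ (b ⊗ xz) = b x ⊗ z + z b ⊗ x`, `d₂ (c ⊗ zy) = c z ⊗ y + y c ⊗ z`. -/
def kosD2 : K2 k →ₗ[k] K1 k :=
  Finsupp.lsum k fun
    | Quad.xxyx =>
        kos1 k Gen.x ∘ₗ
          (LinearMap.mulRight k (x k + y k) + LinearMap.mulLeft k (x k))
        + kos1 k Gen.y ∘ₗ LinearMap.mulLeft k (x k)
    | Quad.xz =>
        kos1 k Gen.z ∘ₗ LinearMap.mulRight k (x k)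
        + kos1 k Gen.x ∘ₗ LinearMap.mulLeft k (z k)
    | Quad.zy =>
        kos1 k Gen.y ∘ₗ LinearMap.mulRight k (z k)
        + kos1 k Gen.z ∘ₗ LinearMap.mulLeft k (y k)

lemma kosD2_xxyx (a : A k) : kosD2 k (kos2 k Quad.xxyx a)
    = kos1 k Gen.x (a * (x k + y k) + x k * a) + kos1 k Gen.y (x k * a) :=
  Finsupp.lsum_single _ _ _ _

lemma kosD2_xz (a : A k) : kosD2 k (kos2 k Quad.xz a)
    = kos1 k Gen.z (a * x k) + kos1 k Gen.x (z k * a) :=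
  Finsupp.lsum_single _ _ _ _

lemma kosD2_zy (a : A k) : kosD2 k (kos2 k Quad.zy a)
    = kos1 k Gen.y (a * z k) + kos1 k Gen.z (y k * a) :=
  Finsupp.lsum_single _ _ _ _

/-- Homology of the Koszul complex in degree `0`. -/
abbrev KH0 : Type _ := A k ⧸ LinearMap.range (kosD1 k)

/-- Homology of the Koszul complex in degree `1`. -/
abbrev KH1 : Type _ :=
  LinearMap.ker (kosD1 k) ⧸
    (LinearMap.range (kosD2 k)).submoduleOf (LinearMap.ker (kosD1 k))

/-- The class of an element of `A` in Koszul homology of degree `0`. -/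
def cls0 (a : A k) : KH0 k := Submodule.Quotient.mk a

/-- The class of a cycle in Koszul homology of degree `1`. -/
def cls1 (c : K1 k) (hc : kosD1 k c = 0) : KH1 k :=
  Submodule.Quotient.mk ⟨c, hc⟩

lemma kosD1_kos1 (p : Gen) (a : A k) :
    kosD1 k (kos1 k p a) = a * gen k p - gen k p * a := by
  rw [kosD1, kos1]
  exact (Finsupp.lsum_single _ _ _ _).trans (by simp)

/-! ## The comparison of the Koszul complex with the Hochschild complex

It is the identity in degree `0`, and is induced by `V₁ ⊆ A` in degree `1`, and by
`V₂ ⊆ V₁ ⊗ V₁` in degree `2`. -/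

/-- `a ⊗ p ↦ a ⊗ p` from `A ⊗ V₁` to `A ⊗ Ā`. -/
def incl1 : K1 k →ₗ[k] C1 k (A k) :=
  Finsupp.lsum k fun p => (chain1 k (A k)).flip (gen k p)

lemma incl1_kos1 (p : Gen) (a : A k) :
    incl1 k (kos1 k p a) = chain1 k (A k) a (gen k p) := by
  rw [incl1, kos1]
  exact Finsupp.lsum_single _ _ _ _

lemma hochD1_incl1 (c : K1 k) : hochD1 k (A k) (incl1 k c) = kosD1 k c := by
  induction c using K1_induction with
  | h0 => simp
  | ha f g hf hg => simp only [map_add, hf, hg]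
  | hs p a => rw [incl1_kos1, hochD1_chain1, kosD1_kos1]

lemma incl1_kosD2 (c : K2 k) :
    incl1 k (kosD2 k c) ∈ LinearMap.range (hochD2 k (A k)) := by
  induction c using K2_induction with
  | h0 => simp
  | ha f g hf hg => rw [map_add, map_add]; exact Submodule.add_mem _ hf hg
  | hs r a =>
    cases r with
    | xxyx =>
      refine ⟨chain2 k (A k) a (x k) (x k) + chain2 k (A k) a (y k) (x k), ?_⟩
      rw [map_add, hochD2_chain2, hochD2_chain2]
      have h : chain1 k (A k) a (x k * x k) + chain1 k (A k) a (y k * x k) = 0 := by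
        rw [← map_add, rel_xx, map_zero]
      simp only [kosD2_xxyx, map_add, incl1_kos1, mul_add]
      rw [eq_neg_of_add_eq_zero_left h]
      abel
    | xz =>
      refine ⟨chain2 k (A k) a (x k) (z k), ?_⟩
      rw [hochD2_chain2, rel_xz, map_zero, sub_zero]
      simp only [kosD2_xz, map_add, incl1_kos1]
    | zy =>
      refine ⟨chain2 k (A k) a (z k) (y k), ?_⟩
      rw [hochD2_chain2, rel_zy, map_zero, sub_zero]
      simp only [kosD2_zy, map_add, incl1_kos1]

/-- The comparison map on homology in degree `0`, induced by the identity of `A`. -/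
def comp0 : KH0 k →ₗ[k] HH0 k (A k) :=
  Submodule.mapQ _ _ LinearMap.id (by
    rintro _ ⟨c, rfl⟩
    exact ⟨incl1 k c, hochD1_incl1 k c⟩)

/-- The comparison map on homology in degree `1`, induced by `a ⊗ p ↦ a ⊗ p`. -/
def comp1 : KH1 k →ₗ[k] HH1 k (A k) :=
  Submodule.mapQ _ _
    ((incl1 k).restrict (p := LinearMap.ker (kosD1 k)) (q := LinearMap.ker (hochD1 k (A k)))
      (by
        intro c hc
        rw [LinearMap.mem_ker] at hc ⊢
        rw [hochD1_incl1, hc]))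
    (by
      rintro ⟨c, hc⟩ ⟨d, hd⟩
      rw [Submodule.mem_comap]
      change incl1 k c ∈ LinearMap.range (hochD2 k (A k))
      have h := incl1_kosD2 k d
      rw [hd] at h
      exact h)

/-! ## The classes in degree `0` -/

/-- `ζ₀ = 1`. -/
def zeta0 : KH0 k := cls0 k 1

/-- `α₀ = x`. -/
def alpha0 : KH0 k := cls0 k (x k)

/-- `β₀(n) = yⁿ x`. -/
def beta0 (n : ℕ) : KH0 k := cls0 k (y k ^ n * x k)

/-- `γ₀(n) = yⁿ`. -/
def gamma0 (n : ℕ) : KH0 k := cls0 k (y k ^ n)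

/-- `δ₀(m) = zᵐ`. -/
def delta0 (m : ℕ) : KH0 k := cls0 k (z k ^ m)

/-- `y^{n₁} z^{m₁} x y^{n₂} z^{m₂} x ⋯ y^{nₚ} z^{mₚ} x`. -/
def epsWord (L : List (ℕ+ × ℕ+)) : A k :=
  (L.map fun q => y k ^ (q.1 : ℕ) * z k ^ (q.2 : ℕ) * x k).prod

lemma cls0_mul_comm (u w : A k) : cls0 k (u * w) = cls0 k (w * u) := by
  obtain ⟨v, rfl⟩ := toA_surjective k u
  induction v using FreeAlgebra.induction generalizing w with
  | grade0 r => simp only [AlgHom.commutes, Algebra.commutes]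
  | grade1 g =>
    refine (Submodule.Quotient.eq _).2 ⟨kos1 k g (-w), ?_⟩
    rw [kosD1_kos1, gen, neg_mul, mul_neg]
    abel
  | mul a b ha hb =>
    rw [map_mul, mul_assoc, ha, mul_assoc, hb, mul_assoc]
  | add a b ha hb =>
    rw [map_add, add_mul, mul_add]
    exact congrArg₂ (· + ·) (ha w) (hb w)

lemma cls0_epsWord_rotated {L L' : List (ℕ+ × ℕ+)} (h : L ~r L') :
    cls0 k (epsWord k L) = cls0 k (epsWord k L') := by
  obtain ⟨n, rfl⟩ := h
  rw [List.rotate_eq_drop_append_take_mod]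
  conv_lhs => rw [← List.take_append_drop (n % L.length) L]
  simp only [epsWord, List.map_append, List.prod_append]
  exact cls0_mul_comm k _ _

/-- `ε̄₀(n₁, …, nₚ; m₁, …, mₚ)`, the class of `y^{n₁} z^{m₁} x ⋯ y^{nₚ} z^{mₚ} x`. It depends on
the sequence of pairs `(nᵢ, mᵢ)` only up to cyclic permutation. -/
def eps0 : Cycle (ℕ+ × ℕ+) → KH0 k :=
  Quotient.lift (fun L => cls0 k (epsWord k L)) fun _ _ h => cls0_epsWord_rotated k h

/-- The index set of the basis in degree `0`. -/
inductive Idx0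
  | zeta
  | alpha
  | beta (n : ℕ+)
  | gamma (n : ℕ+)
  | delta (m : ℕ+)
  | eps (c : Cycle (ℕ+ × ℕ+)) (hc : c ≠ Cycle.nil)

/-- The family `ζ₀, α₀, β₀(n), γ₀(n), δ₀(m), ε̄₀(n₁, …, nₚ; m₁, …, mₚ)`. -/
def family0 : Idx0 → KH0 k
  | Idx0.zeta => zeta0 k
  | Idx0.alpha => alpha0 k
  | Idx0.beta n => beta0 k n
  | Idx0.gamma n => gamma0 k n
  | Idx0.delta m => delta0 k m
  | Idx0.eps c _ => eps0 k c

/-! ## The classes in degree `1` -/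

/-- `α₁ = 1 ⊗ x`. -/
def alpha1 : KH1 k := cls1 k (kos1 k Gen.x 1) (by simp [kosD1_kos1])

/-- `β₁ = x ⊗ x`. -/
def beta1 : KH1 k := cls1 k (kos1 k Gen.x (x k)) (by simp [kosD1_kos1])

lemma x_mul_pow_mul_x (n : ℕ) : x k * (y k ^ n * x k) = -(y k ^ (n + 1) * x k) := by
  induction n with
  | zero =>
    simpa using eq_neg_of_add_eq_zero_left (rel_xx k)
  | succ n ih =>
    have h : y k ^ n * x k * x k = -(y k ^ (n + 1) * x k) := by
      rw [mul_assoc, eq_neg_of_add_eq_zero_left (rel_xx k), mul_neg, pow_succ, mul_assoc]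
    have h2 : y k ^ (n + 1) * x k = -(y k ^ n * x k * x k) := by rw [h, neg_neg]
    rw [h2, mul_neg, ← mul_assoc, ih, neg_mul, neg_neg, mul_assoc,
      eq_neg_of_add_eq_zero_left (rel_xx k), mul_neg, ← mul_assoc, ← pow_succ]

/-- `γ₁(n) = yⁿ x ⊗ x`. -/
def gamma1 (n : ℕ) : KH1 k := cls1 k (kos1 k Gen.x (y k ^ n * x k)) (by
  rw [kosD1_kos1, x_mul_pow_mul_x, mul_assoc, eq_neg_of_add_eq_zero_left (rel_xx k), mul_neg,
    ← mul_assoc, ← pow_succ, sub_self])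

/-- `δ₁ = 1 ⊗ y`. -/
def delta1 : KH1 k := cls1 k (kos1 k Gen.y 1) (by simp [kosD1_kos1])

/-- `ε₁(n) = yⁿ ⊗ y`. -/
def eps1 (n : ℕ) : KH1 k := cls1 k (kos1 k Gen.y (y k ^ n)) (by
  rw [kosD1_kos1, ← pow_succ, ← pow_succ', sub_self])

/-- `ζ₁ = 1 ⊗ z`. -/
def zeta1 : KH1 k := cls1 k (kos1 k Gen.z 1) (by simp [kosD1_kos1])

/-- `η₁(m) = zᵐ ⊗ z`. -/
def eta1 (m : ℕ) : KH1 k := cls1 k (kos1 k Gen.z (z k ^ m)) (by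
  rw [kosD1_kos1, ← pow_succ, ← pow_succ', sub_self])

/-- `x y^{n₁} z^{m₁} x y^{n₂} z^{m₂} ⋯ x y^{nₚ} z^{mₚ}`. -/
def xWord (L : List (ℕ+ × ℕ+)) : A k :=
  (L.map fun q => x k * y k ^ (q.1 : ℕ) * z k ^ (q.2 : ℕ)).prod

/-- The `i = 1` summand of `θ₁`: for a sequence with first entry `(n, m)` and remaining entries `r`,
and `P = x y^{n₂} z^{m₂} ⋯ x y^{nₚ} z^{mₚ}` the word of `r`, it is
`y^n z^m P ⊗ x + ∑_{t=1}^n y^{n-t} z^m P x y^{t-1} ⊗ y + ∑_{s=1}^m z^{m-s} P x y^n z^{s-1} ⊗ z`. -/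
def thetaTerm : List (ℕ+ × ℕ+) → K1 k
  | [] => 0
  | (n, m) :: r =>
      kos1 k Gen.x (y k ^ (n : ℕ) * z k ^ (m : ℕ) * xWord k r)
      + ∑ t ∈ Finset.Icc 1 (n : ℕ), kos1 k Gen.y
          (y k ^ ((n : ℕ) - t) * z k ^ (m : ℕ) * xWord k r * x k * y k ^ (t - 1))
      + ∑ s ∈ Finset.Icc 1 (m : ℕ), kos1 k Gen.z
          (z k ^ ((m : ℕ) - s) * xWord k r * x k * y k ^ (n : ℕ) * z k ^ (s - 1))

/-- The chain `θ₁`: its `i`-th summand is the first summand for the sequence rotated so as to start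
with `(nᵢ, mᵢ)`. -/
def thetaChain (L : List (ℕ+ × ℕ+)) : K1 k :=
  ∑ i ∈ Finset.range L.length, thetaTerm k (L.rotate i)

lemma telescope (u P : A k) (n : ℕ) :
    ∑ t ∈ Finset.Icc 1 n, (u ^ (n - t) * P * u ^ (t - 1) * u - u * (u ^ (n - t) * P * u ^ (t - 1)))
      = P * u ^ n - u ^ n * P := by
  have h : ∀ t ∈ Finset.range n,
      u ^ (n - (1 + t)) * P * u ^ (1 + t - 1) * u - u * (u ^ (n - (1 + t)) * P * u ^ (1 + t - 1))
        = u ^ (n - (t + 1)) * P * u ^ (t + 1) - u ^ (n - t) * P * u ^ t := by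
    intro t ht
    have ht' := Finset.mem_range.1 ht
    have e : n - t = n - (t + 1) + 1 := by omega
    rw [add_comm 1 t, Nat.add_sub_cancel, e, pow_succ' u (n - (t + 1)), pow_succ u t]
    simp only [mul_assoc]
  rw [← Finset.Ico_add_one_right_eq_Icc, Finset.sum_Ico_eq_sum_range, Nat.add_sub_cancel,
    Finset.sum_congr rfl h,
    Finset.sum_range_sub (fun t => u ^ (n - t) * P * u ^ t) n]
  simp

lemma kosD1_thetaTerm (q : ℕ+ × ℕ+) (r : List (ℕ+ × ℕ+)) :
    kosD1 k (thetaTerm k (q :: r)) = xWord k (r ++ [q]) - xWord k (q :: r) := by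
  obtain ⟨n, m⟩ := q
  have hy := telescope k (y k) (z k ^ (m : ℕ) * xWord k r * x k) n
  have hz := telescope k (z k) (xWord k r * x k * y k ^ (n : ℕ)) m
  simp only [mul_assoc] at hy hz
  simp only [thetaTerm, map_add, map_sum, kosD1_kos1, mul_assoc, hy, hz]
  simp [xWord, mul_assoc]

lemma kosD1_thetaChain (L : List (ℕ+ × ℕ+)) : kosD1 k (thetaChain k L) = 0 := by
  have h : ∀ i ∈ Finset.range L.length, kosD1 k (thetaTerm k (L.rotate i))
      = xWord k (L.rotate (i + 1)) - xWord k (L.rotate i) := by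
    intro i hi
    rw [← List.rotate_rotate]
    cases hL : L.rotate i with
    | nil =>
      have := Finset.mem_range.1 hi
      rw [List.rotate_eq_nil_iff] at hL
      simp [hL] at this
    | cons q r => simp [kosD1_thetaTerm]
  rw [thetaChain, map_sum, Finset.sum_congr rfl h,
    Finset.sum_range_sub (fun i => xWord k (L.rotate i)) L.length]
  simp

/-- `θ₁(n₁, …, nₚ; m₁, …, mₚ)`. -/
def theta1 (L : List (ℕ+ × ℕ+)) : KH1 k := cls1 k (thetaChain k L) (kosD1_thetaChain k L)

end Algebra

end HochConnes

end

/-!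
The proof works with words in the generators. Two facts about linear maps out of `A` carry it: the
monomials span `A`, and a function on words that respects the three relations in every context
extends to a linear map on `A` (`exists_linearMap_of_words`).

**Comparison.** In degree `0` the image of the Koszul differential is already all of `[A, A]`. In
degree `1` the key is the cyclic derivative `D w a = ∑ᵢ pᵢ₊₁ ⋯ pᵣ a p₁ ⋯ pᵢ₋₁ ⊗ pᵢ` of a word
`w = p₁ ⋯ pᵣ`. Repeated use of `d₂` shows that `a ⊗ w` is homologous to `D w a`, so every Hochschild
`1`-chain is homologous to a Koszul chain (`exists_incl1_homologous`). Conversely, a relation inside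
a word contributes a Koszul boundary to `D`, so `D` descends to `A` modulo boundaries
(`exists_cycDeriv_linearMap`), and by the Leibniz rule it kills Hochschild boundaries; it is thus a
left inverse of the comparison map modulo boundaries (`mem_range_kosD2_of_incl1`). No exactness of
the Koszul complex in higher degrees is needed.

**Basis in degree `0`.** Every monomial is `0` or of the form `y^{n₁} z^{m₁} x ⋯ x yⁿ zᵐ`; cyclic
permutation together with `x yⁿ x = -yⁿ⁺¹ x` reduces these to the family (`span_family0`). For
independence, coordinates are defined directly on cyclic words (`wordCoord`): words in `x, y`
containing `x` are `± yⁿ x`, and the remaining members of the family are the cyclic words in which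
none of `xx, yx, xz, zy` occurs, each of which determines its index (`Represents.unique`). This is
compatible with cyclic permutation and with the relations, hence gives a linear map on `HH₀`.

**Connes' differential.** Since `1 ⊗ w` is homologous to `D w 1`, the differential sends the class
of a word to the class of its cyclic derivative (`koszulConnes_monomial`). For `yⁿ x = ± xⁿ⁺¹` and
for powers this is immediate, and for `x y^{n₁} z^{m₁} ⋯ x y^{nₚ} z^{mₚ}`, a cyclic permutation of
the word of `ε̄₀`, the cyclic derivative is `θ₁` on the nose (`cycDeriv_xBlockWord_one`).
-/

noncomputable section

namespace HochConnes

/-! ### Words in the generators -/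

section Words

variable (k : Type*) [Field k]

/-- The monomial of the free algebra spelled by a word. -/
def freeWord (w : List Gen) : FreeAlgebra k Gen := (w.map (FreeAlgebra.ι k)).prod

/-- The monomial of `A` spelled by a word. -/
def monomial (w : List Gen) : A k := (w.map (gen k)).prod

@[simp] lemma monomial_nil : monomial k [] = 1 := rfl

@[simp] lemma monomial_cons (p : Gen) (w : List Gen) :
    monomial k (p :: w) = gen k p * monomial k w := by simp [monomial]

@[simp] lemma monomial_append (u v : List Gen) :
    monomial k (u ++ v) = monomial k u * monomial k v := by simp [monomial]

@[simp] lemma monomial_replicate (n : ℕ) (p : Gen) :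
    monomial k (List.replicate n p) = gen k p ^ n := by simp [monomial]

lemma freeWord_append (u v : List Gen) :
    freeWord k (u ++ v) = freeWord k u * freeWord k v := by simp [freeWord]

lemma toA_freeWord (w : List Gen) : toA k (freeWord k w) = monomial k w := by
  rw [freeWord, monomial, map_list_prod, List.map_map]
  rfl

lemma basisFreeMonoid_apply (w : List Gen) :
    FreeAlgebra.basisFreeMonoid k Gen (FreeMonoid.ofList w) = freeWord k w := by
  simp [FreeAlgebra.basisFreeMonoid, FreeAlgebra.equivMonoidAlgebraFreeMonoid, freeWord,
    FreeMonoid.lift_apply]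

lemma span_freeWord : Submodule.span k (Set.range (freeWord k)) = ⊤ := by
  rw [← (FreeAlgebra.basisFreeMonoid k Gen).span_eq]
  congr 1
  ext v
  constructor
  · rintro ⟨w, rfl⟩
    exact ⟨FreeMonoid.ofList w, basisFreeMonoid_apply k w⟩
  · rintro ⟨w, rfl⟩
    exact ⟨w.toList, (basisFreeMonoid_apply k w.toList).symm⟩

lemma freeAlgebra_linearMap_ext {V : Type*} [AddCommGroup V] [Module k V]
    {f g : FreeAlgebra k Gen →ₗ[k] V} (h : ∀ w, f (freeWord k w) = g (freeWord k w)) : f = g :=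
  LinearMap.ext_on_range (span_freeWord k) h

lemma span_monomial : Submodule.span k (Set.range (monomial k)) = ⊤ := by
  have h : Set.range (monomial k) = (toA k).toLinearMap '' Set.range (freeWord k) := by
    rw [← Set.range_comp]
    exact congrArg Set.range (funext fun w => (toA_freeWord k w).symm)
  rw [h, Submodule.span_image, span_freeWord, Submodule.map_top, LinearMap.range_eq_top]
  exact toA_surjective k

lemma A_induction {P : A k → Prop} (monomial : ∀ w, P (monomial k w))
    (add : ∀ a b, P a → P b → P (a + b)) (smul : ∀ (r : k) a, P a → P (r • a)) (a : A k) : P a := by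
  have ha : a ∈ Submodule.span k (Set.range (HochConnes.monomial k)) := by
    rw [span_monomial]
    exact Submodule.mem_top
  induction ha using Submodule.span_induction with
  | mem _ h => obtain ⟨w, rfl⟩ := h; exact monomial w
  | zero => simpa using smul 0 _ (monomial [])
  | add _ _ _ _ h h' => exact add _ _ h h'
  | smul r _ _ h => exact smul r _ h

lemma A_linearMap_ext {V : Type*} [AddCommGroup V] [Module k V]
    {f g : A k →ₗ[k] V} (h : ∀ w, f (monomial k w) = g (monomial k w)) : f = g :=
  LinearMap.ext_on_range (span_monomial k) h

/-- A linear map on the free algebra that vanishes on the two-sided ideal generated by the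
defining relations identifies elements with the same image in `A`. -/
lemma eq_of_toA_eq {V : Type*} [AddCommGroup V] [Module k V] (f : FreeAlgebra k Gen →ₗ[k] V)
    (hf : ∀ u v, Rels k u v → ∀ a b, f (a * u * b) = f (a * v * b))
    {u v : FreeAlgebra k Gen} (h : toA k u = toA k v) : f u = f v := by
  have hrel : ∀ u v, RingQuot.Rel (Rels k) u v → ∀ a b, f (a * u * b) = f (a * v * b) := by
    intro u v huv
    induction huv with
    | of h => exact hf _ _ h
    | add_left _ ih => intro a b; simp only [mul_add, add_mul, map_add, ih]
    | @mul_left u v c _ ih =>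
      intro a b
      have := ih a (c * b)
      simpa only [mul_assoc] using this
    | @mul_right c u v _ ih =>
      intro a b
      have := ih (a * c) b
      simpa only [mul_assoc] using this
  have hq : Quot.mk (RingQuot.Rel (Rels k)) u = Quot.mk (RingQuot.Rel (Rels k)) v := by
    have h' : RingQuot.mkRingHom (Rels k) u = RingQuot.mkRingHom (Rels k) v := by
      rw [← RingQuot.mkAlgHom_coe k]
      exact h
    rw [RingQuot.mkRingHom_def] at h'
    exact congrArg RingQuot.toQuot h'
  have hgen := Quot.eqvGen_exact hq
  clear hq h
  induction hgen with
  | rel u v h => simpa using hrel u v h 1 1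
  | refl => rfl
  | symm _ _ _ ih => exact ih.symm
  | trans _ _ _ _ _ ih ih' => exact ih.trans ih'

/-- A function on words that is compatible with the three relations in every context extends to
a linear map on `A`. -/
lemma exists_linearMap_of_words {V : Type*} [AddCommGroup V] [Module k V] (f : List Gen → V)
    (hxx : ∀ u v, f (u ++ [Gen.x, Gen.x] ++ v) + f (u ++ [Gen.y, Gen.x] ++ v) = 0)
    (hxz : ∀ u v, f (u ++ [Gen.x, Gen.z] ++ v) = 0)
    (hzy : ∀ u v, f (u ++ [Gen.z, Gen.y] ++ v) = 0) :
    ∃ φ : A k →ₗ[k] V, ∀ w, φ (monomial k w) = f w := by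
  let F : FreeAlgebra k Gen →ₗ[k] V :=
    (FreeAlgebra.basisFreeMonoid k Gen).constr k fun w => f w.toList
  have hF : ∀ w, F (freeWord k w) = f w := by
    intro w
    rw [← basisFreeMonoid_apply]
    exact Module.Basis.constr_basis _ _ _ _
  -- by bilinearity, a relation vanishes in every context as soon as it does so between words
  have key : ∀ r : FreeAlgebra k Gen,
      (∀ u v, F (freeWord k u * r * freeWord k v) = 0) → ∀ a b, F (a * r * b) = 0 := by
    intro r hr a b
    let B : FreeAlgebra k Gen →ₗ[k] FreeAlgebra k Gen →ₗ[k] V :=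
      ((LinearMap.mul k (FreeAlgebra k Gen)).compr₂ F) ∘ₗ LinearMap.mulRight k r
    have hB : B = 0 := by
      apply freeAlgebra_linearMap_ext
      intro u
      apply freeAlgebra_linearMap_ext
      intro v
      exact hr u v
    exact LinearMap.congr_fun (LinearMap.congr_fun hB a) b
  have hι : ∀ p q, FreeAlgebra.ι k p * FreeAlgebra.ι k q = freeWord k [p, q] := by
    intro p q; simp [freeWord]
  have hF' : ∀ u v, toA k u = toA k v → F u = F v := by
    intro u v
    apply eq_of_toA_eq
    intro u v h a b
    rw [← sub_eq_zero, ← map_sub, ← sub_mul, ← mul_sub]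
    revert a b
    apply key
    intro u' v'
    cases h with
    | xxyx => simp only [sub_zero, hι, mul_add, add_mul, ← freeWord_append, map_add, hF, hxx]
    | xz => simp only [sub_zero, hι, ← freeWord_append, hF, hxz]
    | zy => simp only [sub_zero, hι, ← freeWord_append, hF, hzy]
  obtain ⟨g, hg⟩ := (toA k).toLinearMap.exists_rightInverse_of_surjective
    (LinearMap.range_eq_top.2 (toA_surjective k))
  refine ⟨F ∘ₗ g, fun w => ?_⟩
  rw [← toA_freeWord, ← hF w]
  exact hF' _ _ (LinearMap.congr_fun hg (toA k (freeWord k w)))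

end Words

/-! ### Cyclic derivatives and the comparison in degree `1` -/

section Derivative

variable (k : Type*) [Field k]

/-- The cyclic derivative of a word `p₁ ⋯ pᵣ` with coefficient `a`:
`∑ᵢ pᵢ₊₁ ⋯ pᵣ a p₁ ⋯ pᵢ₋₁ ⊗ pᵢ`, as a linear function of `a`. -/
def cycDeriv : List Gen → A k →ₗ[k] K1 k
  | [] => 0
  | p :: w => kos1 k p ∘ₗ LinearMap.mulLeft k (monomial k w)
      + cycDeriv w ∘ₗ LinearMap.mulRight k (gen k p)

@[simp] lemma cycDeriv_nil (a : A k) : cycDeriv k [] a = 0 := rfl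

lemma cycDeriv_cons (p : Gen) (w : List Gen) (a : A k) :
    cycDeriv k (p :: w) a = kos1 k p (monomial k w * a) + cycDeriv k w (a * gen k p) := rfl

lemma cycDeriv_append (u v : List Gen) (a : A k) :
    cycDeriv k (u ++ v) a
      = cycDeriv k u (monomial k v * a) + cycDeriv k v (a * monomial k u) := by
  induction u generalizing a with
  | nil => simp
  | cons p u ih =>
    simp only [List.cons_append, cycDeriv_cons, ih, monomial_append, monomial_cons, mul_assoc,
      add_assoc]

lemma kosD1_cycDeriv (w : List Gen) (a : A k) :
    kosD1 k (cycDeriv k w a) = a * monomial k w - monomial k w * a := by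
  induction w generalizing a with
  | nil => simp
  | cons p w ih =>
    rw [cycDeriv_cons, map_add, kosD1_kos1, ih, monomial_cons]
    simp only [mul_assoc]
    abel

/-- In the Hochschild complex, `a ⊗ w` is homologous to the cyclic derivative of `w`. -/
lemma chain1_sub_incl1_cycDeriv (w : List Gen) (a : A k) :
    chain1 k (A k) a (monomial k w) - incl1 k (cycDeriv k w a)
      ∈ LinearMap.range (hochD2 k (A k)) := by
  induction w generalizing a with
  | nil => simp [chain1_one]
  | cons p w ih =>
    have h1 : hochD2 k (A k) (chain2 k (A k) a (gen k p) (monomial k w))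
      ∈ LinearMap.range (hochD2 k (A k)) := ⟨_, rfl⟩
    have h2 := Submodule.sub_mem _ (ih (a * gen k p)) h1
    rw [hochD2_chain2] at h2
    convert h2 using 1
    rw [cycDeriv_cons, map_add, incl1_kos1, monomial_cons]
    abel

lemma chain2_induction {R : Type*} [Ring R] [Algebra k R] {p : C2 k R → Prop} (h0 : p 0)
    (ht : ∀ a b c, p (chain2 k R a b c)) (ha : ∀ u v, p u → p v → p (u + v)) (u : C2 k R) :
    p u := by
  refine TensorProduct.induction_on (motive := p) u h0 (fun a s => ?_) ha
  refine TensorProduct.induction_on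
    (motive := fun s => p (a ⊗ₜ[k] s : R ⊗[k] (Bar k R ⊗[k] Bar k R))) s ?_ ?_ ?_
  · rw [TensorProduct.tmul_zero]
    exact h0
  · intro b c
    obtain ⟨b, rfl⟩ := bar_surjective k R b
    obtain ⟨c, rfl⟩ := bar_surjective k R c
    exact ht a b c
  · intro s s' hs hs'
    rw [TensorProduct.tmul_add]
    exact ha _ _ hs hs'

lemma hochD1_hochD2 (R : Type*) [Ring R] [Algebra k R] (t : C2 k R) :
    hochD1 k R (hochD2 k R t) = 0 := by
  induction t using chain2_induction with
  | h0 => simp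
  | ht a b c =>
    simp only [hochD2_chain2, map_add, map_sub, hochD1_chain1, mul_assoc]
    abel
  | ha u v hu hv => rw [map_add, map_add, hu, hv, add_zero]

lemma exists_incl1_homologous (u : C1 k (A k)) :
    ∃ c : K1 k, u - incl1 k c ∈ LinearMap.range (hochD2 k (A k)) := by
  let S : Submodule k (C1 k (A k)) := LinearMap.range (incl1 k) ⊔ LinearMap.range (hochD2 k (A k))
  have hS : u ∈ S := by
    induction u using C1_induction with
    | h0 => exact zero_mem _
    | ha u v hu hv => exact add_mem hu hv
    | ht a b =>
      have h : S.mkQ ∘ₗ chain1 k (A k) a = 0 := by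
        apply A_linearMap_ext
        intro w
        refine (Submodule.Quotient.mk_eq_zero _).2 ?_
        rw [← sub_add_cancel (chain1 k (A k) a (monomial k w)) (incl1 k (cycDeriv k w a))]
        exact add_mem (Submodule.mem_sup_right (chain1_sub_incl1_cycDeriv k w a))
          (Submodule.mem_sup_left ⟨_, rfl⟩)
      exact (Submodule.Quotient.mk_eq_zero _).1 (LinearMap.congr_fun h b)
  obtain ⟨_, ⟨c, rfl⟩, v, hv, rfl⟩ := Submodule.mem_sup.1 hS
  exact ⟨c, by simpa using hv⟩

/-- Modulo Koszul boundaries the cyclic derivative of a word depends only on the monomial of `A`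
that it spells: a relation `r` inside `u r v` contributes `d₂ (v a u ⊗ r)`. -/
lemma exists_cycDeriv_linearMap :
    ∃ ψ : A k →ₗ[k] A k →ₗ[k] (K1 k ⧸ LinearMap.range (kosD2 k)),
      ∀ w, ψ (monomial k w) = (LinearMap.range (kosD2 k)).mkQ ∘ₗ cycDeriv k w := by
  apply exists_linearMap_of_words
  · intro u v
    ext a
    rw [LinearMap.add_apply, LinearMap.comp_apply, LinearMap.comp_apply, ← map_add]
    refine (Submodule.Quotient.mk_eq_zero _).2 ?_
    refine ⟨kos2 k Quad.xxyx (monomial k v * a * monomial k u), ?_⟩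
    rw [kosD2_xxyx]
    have hx : x k * x k = -(y k * x k) := eq_neg_of_add_eq_zero_left (rel_xx k)
    simp only [cycDeriv_append, cycDeriv_cons, cycDeriv_nil, monomial_append, monomial_cons,
      monomial_nil, mul_one, one_mul, hx, neg_mul, mul_neg, map_neg, mul_add, map_add, mul_assoc]
    abel
  · intro u v
    ext a
    refine (Submodule.Quotient.mk_eq_zero _).2 ?_
    refine ⟨kos2 k Quad.xz (monomial k v * a * monomial k u), ?_⟩
    rw [kosD2_xz]
    simp only [cycDeriv_append, cycDeriv_cons, monomial_append, monomial_cons,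
      monomial_nil, mul_one, one_mul, rel_xz, zero_mul, mul_zero, map_zero, mul_assoc]
    abel
  · intro u v
    ext a
    refine (Submodule.Quotient.mk_eq_zero _).2 ?_
    refine ⟨kos2 k Quad.zy (monomial k v * a * monomial k u), ?_⟩
    rw [kosD2_zy]
    simp only [cycDeriv_append, cycDeriv_cons, monomial_append, monomial_cons,
      monomial_nil, mul_one, one_mul, rel_zy, zero_mul, mul_zero, map_zero, mul_assoc]
    abel

/-- The comparison of chains in degree `1` has a left inverse modulo boundaries. -/
lemma mem_range_kosD2_of_incl1 {c : K1 k}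
    (hc : incl1 k c ∈ LinearMap.range (hochD2 k (A k))) : c ∈ LinearMap.range (kosD2 k) := by
  obtain ⟨ψ, hψ⟩ := exists_cycDeriv_linearMap k
  have hψ1 : ψ 1 = 0 := by
    have := hψ []
    simp only [monomial_nil] at this
    rw [this]
    rfl
  have leib : ∀ b c a, ψ (b * c) a = ψ b (c * a) + ψ c (a * b) := by
    intro b c a
    induction b using A_induction with
    | add b b' hb hb' =>
      simp only [add_mul, mul_add, map_add, LinearMap.add_apply, hb, hb']
      abel
    | smul r b hb => simp only [smul_mul_assoc, mul_smul_comm, map_smul, LinearMap.smul_apply, hb,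
        smul_add]
    | monomial u =>
      induction c using A_induction with
      | add c c' hc hc' =>
        simp only [add_mul, mul_add, map_add, LinearMap.add_apply, hc, hc']
        abel
      | smul r c hc => simp only [smul_mul_assoc, mul_smul_comm, map_smul, LinearMap.smul_apply,
          hc, smul_add]
      | monomial v =>
        rw [← monomial_append, hψ, hψ, hψ, LinearMap.comp_apply, cycDeriv_append, map_add]
        rfl
  let Ψ : C1 k (A k) →ₗ[k] (K1 k ⧸ LinearMap.range (kosD2 k)) :=
    TensorProduct.lift (barLift k (A k) ψ hψ1).flip
  have hΨ : ∀ a b, Ψ (chain1 k (A k) a b) = ψ b a := fun _ _ => rfl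
  have hincl : Ψ ∘ₗ incl1 k = (LinearMap.range (kosD2 k)).mkQ := by
    ext c
    induction c using K1_induction with
    | h0 => simp
    | ha u v hu hv => rw [map_add, map_add, hu, hv]
    | hs p a =>
      have := LinearMap.congr_fun (hψ [p]) a
      rw [LinearMap.comp_apply, incl1_kos1, hΨ]
      simpa [cycDeriv_cons] using this
  obtain ⟨t, ht⟩ := hc
  have hΨd : Ψ (hochD2 k (A k) t) = 0 := by
    clear ht
    induction t using chain2_induction with
    | h0 => rw [map_zero, map_zero]
    | ht a b c =>
      rw [hochD2_chain2, map_add, map_sub, hΨ, hΨ, hΨ, leib]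
      abel
    | ha u v hu hv => rw [map_add, map_add, hu, hv, add_zero]
  rw [ht] at hΨd
  exact (Submodule.Quotient.mk_eq_zero _).1 ((LinearMap.congr_fun hincl c).symm.trans hΨd)

lemma comp1_bijective : Function.Bijective (comp1 k) := by
  constructor
  · rw [← LinearMap.ker_eq_bot, LinearMap.ker_eq_bot']
    intro t ht
    obtain ⟨⟨c, hc⟩, rfl⟩ := Submodule.Quotient.mk_surjective _ t
    refine (Submodule.Quotient.mk_eq_zero _).2 ?_
    have h := (Submodule.Quotient.mk_eq_zero
      ((LinearMap.range (hochD2 k (A k))).submoduleOf (LinearMap.ker (hochD1 k (A k))))).1 ht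
    exact mem_range_kosD2_of_incl1 k h
  · intro t
    obtain ⟨⟨u, hu⟩, rfl⟩ := Submodule.Quotient.mk_surjective _ t
    obtain ⟨c, v, hv⟩ := exists_incl1_homologous k u
    have hd : hochD1 k (A k) (hochD2 k (A k) v) = 0 := hochD1_hochD2 k (A k) v
    have hc : kosD1 k c = 0 := by
      rw [hv, map_sub, hochD1_incl1, LinearMap.mem_ker.1 hu, zero_sub, neg_eq_zero] at hd
      exact hd
    refine ⟨cls1 k c hc, ?_⟩
    refine ((Submodule.Quotient.eq _).2 ?_).symm
    exact ⟨v, hv⟩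

lemma comp0_bijective : Function.Bijective (comp0 k) := by
  constructor
  · rw [← LinearMap.ker_eq_bot, LinearMap.ker_eq_bot']
    intro t ht
    obtain ⟨a, rfl⟩ := Submodule.Quotient.mk_surjective _ t
    obtain ⟨u, rfl⟩ := (Submodule.Quotient.mk_eq_zero (LinearMap.range (hochD1 k (A k)))).1 ht
    refine (Submodule.Quotient.mk_eq_zero _).2 ?_
    clear ht
    induction u using C1_induction with
    | h0 => simp
    | ha u v hu hv =>
      rw [map_add]
      exact add_mem hu hv
    | ht a b => exact (Submodule.Quotient.eq _).1 (cls0_mul_comm k a b)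
  · intro t
    obtain ⟨a, rfl⟩ := Submodule.Quotient.mk_surjective _ t
    exact ⟨Submodule.Quotient.mk a, rfl⟩

end Derivative

/-! ### The family spans `HH₀` -/

section Span

variable (k : Type*) [Field k]

/-- The element `y^{n₁} z^{m₁} x ⋯ y^{nₚ} z^{mₚ} x` of `A`, where zero exponents are allowed. -/
def blockProd (L : List (ℕ × ℕ)) : A k :=
  (L.map fun q => y k ^ q.1 * z k ^ q.2 * x k).prod

@[simp] lemma blockProd_nil : blockProd k [] = 1 := rfl

@[simp] lemma blockProd_cons (q : ℕ × ℕ) (L : List (ℕ × ℕ)) :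
    blockProd k (q :: L) = y k ^ q.1 * z k ^ q.2 * x k * blockProd k L := by simp [blockProd]

@[simp] lemma blockProd_append (L L' : List (ℕ × ℕ)) :
    blockProd k (L ++ L') = blockProd k L * blockProd k L' := by simp [blockProd]

lemma z_pow_succ_mul_y_pow_succ (m n : ℕ) : z k ^ (m + 1) * y k ^ (n + 1) = 0 := by
  rw [pow_succ, pow_succ', mul_assoc, ← mul_assoc (z k) (y k), rel_zy, zero_mul, mul_zero]

lemma x_mul_z_pow_succ (m : ℕ) : x k * z k ^ (m + 1) = 0 := by
  rw [pow_succ', ← mul_assoc, rel_xz, zero_mul]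

lemma gen_mul_blockProd (p : Gen) (L : List (ℕ × ℕ)) (n m : ℕ) :
    gen k p * (blockProd k L * (y k ^ n * z k ^ m)) = 0 ∨
      ∃ L' n' m', gen k p * (blockProd k L * (y k ^ n * z k ^ m))
        = blockProd k L' * (y k ^ n' * z k ^ m') := by
  cases p with
  | x => exact Or.inr ⟨(0, 0) :: L, n, m, by simp [mul_assoc]⟩
  | y =>
    rcases L with - | ⟨⟨a, b⟩, L⟩
    · exact Or.inr ⟨[], n + 1, m, by simp [pow_succ', mul_assoc]⟩
    · exact Or.inr ⟨(a + 1, b) :: L, n, m, by simp [pow_succ', mul_assoc]⟩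
  | z =>
    rcases L with - | ⟨⟨a, b⟩, L⟩
    · rcases n with - | n
      · exact Or.inr ⟨[], 0, m + 1, by simp [pow_succ']⟩
      · left
        have h := z_pow_succ_mul_y_pow_succ k 0 n
        rw [zero_add, pow_one] at h
        rw [blockProd_nil, one_mul, ← mul_assoc, h, zero_mul]
    · rcases a with - | a
      · exact Or.inr ⟨(0, b + 1) :: L, n, m, by simp [pow_succ', mul_assoc]⟩
      · left
        have h := z_pow_succ_mul_y_pow_succ k 0 a
        rw [zero_add, pow_one] at h
        simp only [blockProd_cons, ← mul_assoc, h, zero_mul]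

lemma monomial_eq_blockProd (w : List Gen) :
    monomial k w = 0 ∨ ∃ L n m, monomial k w = blockProd k L * (y k ^ n * z k ^ m) := by
  induction w with
  | nil => exact Or.inr ⟨[], 0, 0, by simp⟩
  | cons p w ih =>
    rw [monomial_cons]
    rcases ih with h | ⟨L, n, m, h⟩
    · exact Or.inl (by rw [h, mul_zero])
    · rw [h]
      exact gen_mul_blockProd k p L n m

lemma cls0_mem_span_y_pow_mul_x (n : ℕ) :
    cls0 k (y k ^ n * x k) ∈ Submodule.span k (Set.range (family0 k)) := by
  rcases n with - | n
  · rw [pow_zero, one_mul]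
    exact Submodule.subset_span ⟨Idx0.alpha, rfl⟩
  · exact Submodule.subset_span ⟨Idx0.beta n.succPNat, rfl⟩

/-- Cyclic words containing `x` reduce to the family: a block `(n, 0)` is merged with the block
before it by `x yⁿ x = -yⁿ⁺¹ x`, and a block `(0, m)` with `m > 0` is killed by the `x` before it. -/
lemma cls0_blockProd_mem_span (L : List (ℕ × ℕ)) (hL : L ≠ []) :
    cls0 k (blockProd k L) ∈ Submodule.span k (Set.range (family0 k)) := by
  induction hl : L.length using Nat.strong_induction_on generalizing L with
  | _ l ih =>
  -- if all exponents are positive, the word is one of the `ε̄₀`; otherwise a block with a zero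
  -- exponent is rotated to the end, where the block before it acts on it
  by_cases hpos : ∀ q ∈ L, 0 < q.1 ∧ 0 < q.2
  · obtain ⟨L', rfl⟩ : ∃ L' : List (ℕ+ × ℕ+), L'.map (fun q => ((q.1 : ℕ), (q.2 : ℕ))) = L := by
      clear ih hl hL
      induction L with
      | nil => exact ⟨[], rfl⟩
      | cons q L ih =>
        obtain ⟨L', rfl⟩ := ih fun q hq => hpos q (List.mem_cons_of_mem _ hq)
        have := hpos q List.mem_cons_self
        exact ⟨(⟨q.1, this.1⟩, ⟨q.2, this.2⟩) :: L', rfl⟩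
    have hne : (L' : Cycle (ℕ+ × ℕ+)) ≠ Cycle.nil := by
      rw [Ne, Cycle.coe_eq_nil]
      rintro rfl
      exact hL rfl
    refine Submodule.subset_span ⟨Idx0.eps (L' : Cycle (ℕ+ × ℕ+)) hne, ?_⟩
    change cls0 k (epsWord k L') = _
    rw [blockProd, List.map_map]
    rfl
  · push Not at hpos
    obtain ⟨⟨n, m⟩, hq, hnm⟩ := hpos
    obtain ⟨s, t, rfl⟩ := List.append_of_mem hq
    have hrot : cls0 k (blockProd k (s ++ (n, m) :: t))
        = cls0 k (blockProd k ((t ++ s) ++ [(n, m)])) := by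
      rw [← List.singleton_append, ← List.append_assoc, blockProd_append, cls0_mul_comm,
        ← blockProd_append, List.append_assoc]
    rw [hrot]
    have hlen : (t ++ s).length + 1 = l := by simp at hl ⊢; omega
    generalize t ++ s = R at hlen
    rcases m with - | m
    · rcases List.eq_nil_or_concat' R with rfl | ⟨R, ⟨a, b⟩, rfl⟩
      · simpa using cls0_mem_span_y_pow_mul_x k n
      · have hx := x_mul_pow_mul_x k n
        have hred : blockProd k (R ++ [(a, b)] ++ [(n, 0)])
            = -(blockProd k R * (y k ^ a * (z k ^ b * y k ^ (n + 1)) * x k)) := by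
          simp only [blockProd_append, blockProd_cons, blockProd_nil, mul_one, pow_zero, mul_assoc,
            hx, mul_neg]
        rw [hred]
        rcases b with - | b
        · have := ih (R ++ [(a + n + 1, 0)]).length (by simp at hlen ⊢; omega)
            (R ++ [(a + n + 1, 0)]) (by simp) rfl
          have h2 := Submodule.neg_mem _ this
          convert h2 using 1
          simp only [blockProd_append, blockProd_cons, blockProd_nil, pow_zero, mul_one, one_mul,
            ← pow_add, add_assoc]
          rfl
        · rw [z_pow_succ_mul_y_pow_succ, mul_zero, zero_mul, mul_zero, neg_zero]
          exact zero_mem _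
    · have hn : n = 0 := by
        by_contra h
        exact absurd (hnm (Nat.pos_of_ne_zero h)) (by simp)
      subst hn
      rcases List.eq_nil_or_concat' R with rfl | ⟨R, ⟨a, b⟩, rfl⟩
      · simp only [List.nil_append, blockProd_cons, blockProd_nil, pow_zero, one_mul, mul_one]
        rw [cls0_mul_comm, x_mul_z_pow_succ]
        exact zero_mem _
      · simp only [blockProd_append, blockProd_cons, blockProd_nil, pow_zero, one_mul, mul_one,
          mul_assoc]
        rw [← mul_assoc (x k), x_mul_z_pow_succ]
        simp only [zero_mul, mul_zero]
        exact zero_mem _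

lemma cls0_blockProd_mul_mem_span (L : List (ℕ × ℕ)) (n m : ℕ) :
    cls0 k (blockProd k L * (y k ^ n * z k ^ m)) ∈ Submodule.span k (Set.range (family0 k)) := by
  rw [cls0_mul_comm]
  rcases L with - | ⟨⟨a, b⟩, L⟩
  · rw [blockProd_nil, mul_one]
    rcases n with - | n
    · rw [pow_zero, one_mul]
      rcases m with - | m
      · rw [pow_zero]
        exact Submodule.subset_span ⟨Idx0.zeta, rfl⟩
      · exact Submodule.subset_span ⟨Idx0.delta m.succPNat, rfl⟩
    · rcases m with - | m
      · rw [pow_zero, mul_one]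
        exact Submodule.subset_span ⟨Idx0.gamma n.succPNat, rfl⟩
      · rw [cls0_mul_comm, z_pow_succ_mul_y_pow_succ]
        exact zero_mem _
  · rcases m with - | m
    · have := cls0_blockProd_mem_span k ((n + a, b) :: L) (by simp)
      simpa [pow_add, mul_assoc] using this
    · rcases a with - | a
      · have := cls0_blockProd_mem_span k ((n, m + 1 + b) :: L) (by simp)
        simpa [pow_add, mul_assoc] using this
      · have : y k ^ n * z k ^ (m + 1) * blockProd k ((a + 1, b) :: L)
            = y k ^ n * (z k ^ (m + 1) * y k ^ (a + 1)) * (z k ^ b * x k * blockProd k L) := by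
          simp only [blockProd_cons, mul_assoc]
        rw [this, z_pow_succ_mul_y_pow_succ, mul_zero, zero_mul]
        exact zero_mem _

lemma span_family0 : Submodule.span k (Set.range (family0 k)) = ⊤ := by
  rw [eq_top_iff]
  rintro t -
  obtain ⟨a, rfl⟩ := Submodule.Quotient.mk_surjective _ t
  induction a using A_induction with
  | monomial w =>
    rcases monomial_eq_blockProd k w with h | ⟨L, n, m, h⟩
    · rw [h]
      exact zero_mem _
    · rw [h]
      exact cls0_blockProd_mul_mem_span k L n m
  | add a b ha hb => exact add_mem ha hb
  | smul r a ha => exact Submodule.smul_mem _ r ha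

end Span

/-! ### The cyclic words of the degree `0` classes -/

section CyclicWords

instance : DecidableEq Gen := Classical.decEq _

/-- The word `y^{n₁} z^{m₁} x ⋯ y^{nₚ} z^{mₚ} x`. -/
def blockWord (L : List (ℕ+ × ℕ+)) : List Gen :=
  L.flatMap fun q => List.replicate q.1 Gen.y ++ List.replicate q.2 Gen.z ++ [Gen.x]

@[simp] lemma blockWord_nil : blockWord [] = [] := rfl

lemma blockWord_cons (q : ℕ+ × ℕ+) (L : List (ℕ+ × ℕ+)) :
    blockWord (q :: L)
      = List.replicate q.1 Gen.y ++ List.replicate q.2 Gen.z ++ [Gen.x] ++ blockWord L := rfl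

@[simp] lemma blockWord_append (L L' : List (ℕ+ × ℕ+)) :
    blockWord (L ++ L') = blockWord L ++ blockWord L' := by simp [blockWord]

lemma replicate_append_inj {α : Type*} {a : α} {n n' : ℕ} {u u' : List α}
    (hu : u.head? ≠ some a) (hu' : u'.head? ≠ some a)
    (h : List.replicate n a ++ u = List.replicate n' a ++ u') : n = n' ∧ u = u' := by
  induction n generalizing n' with
  | zero =>
    cases n' with
    | zero => exact ⟨rfl, h⟩
    | succ n' =>
      simp only [List.replicate_zero, List.nil_append] at h
      exact absurd (by rw [h]; rfl) hu
  | succ n ih =>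
    cases n' with
    | zero =>
      simp only [List.replicate_zero, List.nil_append] at h
      exact absurd (by rw [← h]; rfl) hu'
    | succ n' =>
      simp only [List.replicate_succ, List.cons_append, List.cons.injEq, true_and] at h
      obtain ⟨rfl, h2⟩ := ih h
      exact ⟨rfl, h2⟩

lemma blockWord_injective : Function.Injective blockWord := by
  intro L
  induction L with
  | nil =>
    rintro (- | ⟨q, L'⟩) h
    · rfl
    · simp [blockWord_cons] at h
  | cons q L ih =>
    rintro (- | ⟨q', L'⟩) h
    · simp [blockWord_cons] at h
    · simp only [blockWord_cons, List.append_assoc] at h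
      have hz : ∀ (m : ℕ+) (s : List Gen),
          (List.replicate (m : ℕ) Gen.z ++ s).head? ≠ some Gen.y := by
        intro m s
        rw [← Nat.succ_pred_eq_of_pos m.pos, List.replicate_succ]
        simp
      obtain ⟨h1, h⟩ := replicate_append_inj (hz _ _) (hz _ _) h
      obtain ⟨h2, h⟩ := replicate_append_inj (by simp) (by simp) h
      rw [List.append_cancel_left_eq] at h
      rw [ih h, Prod.ext (PNat.eq h1) (PNat.eq h2)]

lemma getLast?_blockWord {L : List (ℕ+ × ℕ+)} (hL : L ≠ []) :
    (blockWord L).getLast? = some Gen.x := by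
  rcases List.eq_nil_or_concat' L with rfl | ⟨L, q, rfl⟩
  · exact absurd rfl hL
  · simp [blockWord_cons]

/-- A block word can only be cut behind an `x` at the border of two blocks. -/
lemma exists_of_blockWord_eq_append {L : List (ℕ+ × ℕ+)} {u v : List Gen}
    (h : blockWord L = u ++ v) (hu : u = [] ∨ u.getLast? = some Gen.x) :
    ∃ L₁ L₂, L = L₁ ++ L₂ ∧ u = blockWord L₁ ∧ v = blockWord L₂ := by
  induction L generalizing u with
  | nil =>
    simp only [blockWord_nil, List.nil_eq_append_iff] at h
    exact ⟨[], [], rfl, h.1, h.2⟩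
  | cons q L ih =>
    rcases hu with rfl | hu
    · exact ⟨[], q :: L, rfl, rfl, h.symm⟩
    rw [blockWord_cons, List.append_eq_append_iff] at h
    rcases h with ⟨c, rfl, h⟩ | ⟨c, h, rfl⟩
    · obtain ⟨L₁, L₂, rfl, rfl, rfl⟩ := ih h (by
        rcases List.eq_nil_or_concat' c with rfl | ⟨c, p, rfl⟩
        · exact Or.inl rfl
        · right
          rw [← List.append_assoc, List.getLast?_concat] at hu
          rw [List.getLast?_concat, hu])
      exact ⟨q :: L₁, L₂, rfl, rfl, rfl⟩
    · rcases List.eq_nil_or_concat' c with rfl | ⟨c, p, rfl⟩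
      · rw [List.append_nil] at h
        exact ⟨[q], L, rfl, by rw [← h]; simp [blockWord_cons], rfl⟩
      · rw [← List.append_assoc] at h
        have h' := (List.append_inj' h rfl).1
        have hx : Gen.x ∈ u ++ c := List.mem_append_left _ (List.mem_of_getLast? hu)
        rw [← h'] at hx
        simp at hx

/-- A rotation between two block words moves a prefix that ends in `x`, hence whole blocks. -/
lemma isRotated_of_isRotated_blockWord {L L' : List (ℕ+ × ℕ+)} (hL' : L' ≠ [])
    (h : blockWord L ~r blockWord L') : L ~r L' := by
  obtain ⟨n, h⟩ := h
  rw [List.rotate_eq_drop_append_take_mod] at h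
  generalize n % (blockWord L).length = n at h
  have hsplit := (List.take_append_drop n (blockWord L)).symm
  generalize List.take n (blockWord L) = u at h hsplit
  generalize List.drop n (blockWord L) = v at h hsplit
  obtain ⟨L₁, L₂, rfl, rfl, rfl⟩ := exists_of_blockWord_eq_append hsplit (by
    rcases List.eq_nil_or_concat' u with rfl | ⟨u, p, rfl⟩
    · exact Or.inl rfl
    · right
      rw [← getLast?_blockWord hL', ← h, ← List.append_assoc, List.getLast?_concat,
        List.getLast?_concat])
  rw [← blockWord_append] at h
  rw [← blockWord_injective h]
  exact List.isRotated_append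

/-- The pairs of letters other than `xx`, `yx`, `xz` and `zy`, which occur in the relations. -/
def Admissible : Gen → Gen → Prop
  | Gen.x, Gen.y => True
  | Gen.y, Gen.y => True
  | Gen.y, Gen.z => True
  | Gen.z, Gen.z => True
  | Gen.z, Gen.x => True
  | _, _ => False

lemma isChain_replicate_append {α : Type*} {r : α → α → Prop} {a : α} (ha : r a a) {t : List α}
    (n : ℕ) (h : List.IsChain r (a :: t)) : List.IsChain r (a :: (List.replicate n a ++ t)) := by
  induction n with
  | zero => exact h
  | succ n ih =>
    rw [List.replicate_succ, List.cons_append, List.isChain_cons_cons]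
    exact ⟨ha, ih⟩

/-- The letter `y` is appended because it follows the last `x` cyclically. -/
lemma isChain_blockWord (L : List (ℕ+ × ℕ+)) :
    ∃ t, blockWord L ++ [Gen.y] = Gen.y :: t ∧ List.IsChain Admissible (Gen.y :: t) := by
  induction L with
  | nil => exact ⟨[], rfl, List.isChain_singleton _⟩
  | cons q L ih =>
    obtain ⟨t, ht, hc⟩ := ih
    obtain ⟨n, m⟩ := q
    refine ⟨List.replicate n.natPred Gen.y ++
      (Gen.z :: (List.replicate m.natPred Gen.z ++ (Gen.x :: Gen.y :: t))), ?_, ?_⟩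
    · rw [blockWord_cons, List.append_assoc, ht, ← PNat.natPred_add_one n,
        ← PNat.natPred_add_one m, List.replicate_succ, List.replicate_succ]
      simp
    · apply isChain_replicate_append trivial
      rw [List.isChain_cons_cons]
      refine ⟨trivial, isChain_replicate_append trivial _ ?_⟩
      rw [List.isChain_cons_cons, List.isChain_cons_cons]
      exact ⟨trivial, trivial, hc⟩

/-- The cyclic words, other than those of `α₀` and `β₀(n)`, that represent members of the family. -/
def Represents : Idx0 → Cycle Gen → Prop
  | Idx0.zeta, c => c = Cycle.nil
  | Idx0.alpha, _ => False
  | Idx0.beta _, _ => False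
  | Idx0.gamma n, c => c = (List.replicate n Gen.y : List Gen)
  | Idx0.delta m, c => c = (List.replicate m Gen.z : List Gen)
  | Idx0.eps d _, c => ∃ L : List (ℕ+ × ℕ+), d = L ∧ c = (blockWord L : List Gen)

lemma chain_replicate {p : Gen} (hp : Admissible p p) (n : ℕ) :
    Cycle.Chain Admissible (List.replicate n p : List Gen) := by
  cases n with
  | zero => exact Cycle.Chain.nil _
  | succ n =>
    rw [List.replicate_succ, Cycle.chain_coe_cons]
    exact isChain_replicate_append hp n (by simpa using hp)

/-- No relation applies to these cyclic words, so they are their own normal forms. -/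
lemma Represents.chain {i : Idx0} {c : Cycle Gen} (h : Represents i c) :
    Cycle.Chain Admissible c := by
  cases i with
  | zeta => subst h; exact Cycle.Chain.nil _
  | alpha => exact h.elim
  | beta n => exact h.elim
  | gamma n => subst h; exact chain_replicate (p := Gen.y) trivial _
  | delta m => subst h; exact chain_replicate (p := Gen.z) trivial _
  | eps d hd =>
    obtain ⟨L, rfl, rfl⟩ := h
    obtain ⟨t, ht, hc⟩ := isChain_blockWord L
    cases hw : blockWord L with
    | nil => exact Cycle.Chain.nil _
    | cons p s =>
      rw [hw, List.cons_append, List.cons.injEq] at ht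
      obtain ⟨rfl, rfl⟩ := ht
      exact (Cycle.chain_coe_cons _ _ _).2 hc

lemma mem_blockWord {L : List (ℕ+ × ℕ+)} (hL : L ≠ []) (p : Gen) : p ∈ blockWord L := by
  rcases L with - | ⟨⟨n, m⟩, L⟩
  · exact absurd rfl hL
  · cases p <;> simp [blockWord_cons]

lemma Represents.mem_x_iff {i : Idx0} {c : Cycle Gen} (h : Represents i c) :
    Gen.x ∈ c ↔ ∃ d hd, i = Idx0.eps d hd := by
  cases i with
  | zeta => subst h; simp
  | alpha => exact h.elim
  | beta n => exact h.elim
  | gamma n => subst h; simp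
  | delta m => subst h; simp
  | eps d hd =>
    obtain ⟨L, rfl, rfl⟩ := h
    exact ⟨fun _ => ⟨_, hd, rfl⟩, fun _ => mem_blockWord (by simpa using hd) _⟩

lemma Represents.mem_z_of_mem_x {i : Idx0} {c : Cycle Gen} (h : Represents i c)
    (hx : Gen.x ∈ c) : Gen.z ∈ c := by
  obtain ⟨d, hd, rfl⟩ := h.mem_x_iff.1 hx
  obtain ⟨L, rfl, rfl⟩ := h
  exact mem_blockWord (by simpa using hd) _

lemma Represents.unique {i j : Idx0} {c : Cycle Gen} (hi : Represents i c)
    (hj : Represents j c) : i = j := by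
  by_cases hx : Gen.x ∈ c
  · obtain ⟨d, hd, rfl⟩ := hi.mem_x_iff.1 hx
    obtain ⟨e, he, rfl⟩ := hj.mem_x_iff.1 hx
    obtain ⟨L, rfl, rfl⟩ := hi
    obtain ⟨L', rfl, h⟩ := hj
    have : (L : Cycle (ℕ+ × ℕ+)) = L' := Cycle.coe_eq_coe.2
      (isRotated_of_isRotated_blockWord (by simpa using he) (Cycle.coe_eq_coe.1 h))
    simp only [this]
  · have hi' : ¬ ∃ d hd, i = Idx0.eps d hd := fun h => hx (hi.mem_x_iff.2 h)
    have hj' : ¬ ∃ d hd, j = Idx0.eps d hd := fun h => hx (hj.mem_x_iff.2 h)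
    have aux : ∀ {n m : ℕ} {p q : Gen}, ((List.replicate n p : List Gen) : Cycle Gen)
        = (List.replicate m q : List Gen) → n = m ∧ (n = 0 ∨ p = q) := by
      intro n m p q h
      have h := (Cycle.coe_eq_coe.1 h).perm
      have h1 : n = m := by simpa using h.length_eq
      refine ⟨h1, ?_⟩
      subst h1
      rcases Nat.eq_zero_or_pos n with h0 | h0
      · exact Or.inl h0
      · right
        have : p ∈ List.replicate n q := h.subset (by simp; omega)
        exact (List.mem_replicate.1 this).2
    cases i with
    | zeta =>
      subst hi
      cases j with
      | gamma n => simpa using (aux (n := 0) (p := Gen.y) hj).1.symm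
      | delta n => simpa using (aux (n := 0) (p := Gen.y) hj).1.symm
      | zeta => rfl
      | alpha => exact hj.elim
      | beta n => exact hj.elim
      | eps d hd => exact absurd ⟨d, hd, rfl⟩ hj'
    | alpha => exact hi.elim
    | beta n => exact hi.elim
    | eps d hd => exact absurd ⟨d, hd, rfl⟩ hi'
    | gamma n =>
      subst hi
      cases j with
      | gamma m => rw [PNat.eq (aux hj).1]
      | delta m => simpa using (aux hj).2
      | zeta => simpa using (aux (m := 0) (q := Gen.y) hj).1
      | alpha => exact hj.elim
      | beta n => exact hj.elim
      | eps d hd => exact absurd ⟨d, hd, rfl⟩ hj'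
    | delta n =>
      subst hi
      cases j with
      | gamma m => simpa using (aux hj).2
      | delta m => rw [PNat.eq (aux hj).1]
      | zeta => simpa using (aux (m := 0) (q := Gen.y) hj).1
      | alpha => exact hj.elim
      | beta n => exact hj.elim
      | eps d hd => exact absurd ⟨d, hd, rfl⟩ hj'

end CyclicWords

/-! ### The family is linearly independent -/

section Independence

variable (k : Type*) [Field k]

open scoped Classical in
/-- The basis vector of the index singled out by a predicate, or `0` if there is none.
It is meaningful for predicates that hold for at most one index. -/
def selectIdx (P : Idx0 → Prop) : Idx0 →₀ k :=
  if h : ∃ i, P i then Finsupp.single h.choose 1 else 0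

/-- The index of the class `yⁿ x`. -/
def betaIdx : ℕ → Idx0
  | 0 => Idx0.alpha
  | n + 1 => Idx0.beta n.succPNat

/-- The coordinates of a word in the family: a word in `x, y` with `r ≥ 1` letters `x` and length
`n + 1` is `(-1)^{r-1} yⁿ x`, and the remaining words are either `0` or a member of the family. -/
def wordCoord (w : List Gen) : Idx0 →₀ k :=
  if Gen.x ∈ w ∧ Gen.z ∉ w then
    Finsupp.single (betaIdx (w.length - 1)) ((-1) ^ (w.count Gen.x + 1))
  else selectIdx k fun i => Represents i (w : Cycle Gen)

lemma wordCoord_of_represents {i : Idx0} {w : List Gen}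
    (h : Represents i (w : Cycle Gen)) : wordCoord k w = Finsupp.single i 1 := by
  rw [wordCoord, if_neg fun hw => hw.2 (h.mem_z_of_mem_x hw.1), selectIdx,
    dif_pos ⟨i, h⟩]
  congr 1
  exact Represents.unique (Exists.choose_spec (⟨i, h⟩ : ∃ i, Represents i (w : Cycle Gen))) h

lemma wordCoord_congr {w w' : List Gen} (h : w ~r w') : wordCoord k w = wordCoord k w' := by
  simp only [wordCoord, Cycle.coe_eq_coe.2 h, h.perm.length_eq, h.perm.count_eq, h.mem_iff]

lemma wordCoord_append_comm (u v : List Gen) :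
    wordCoord k (u ++ v) = wordCoord k (v ++ u) :=
  wordCoord_congr k List.isRotated_append

lemma wordCoord_of_not_admissible {p q : Gen} (hpq : ¬ Admissible p q) (w : List Gen)
    (hz : Gen.x ∉ p :: q :: w ∨ Gen.z ∈ p :: q :: w) : wordCoord k (p :: q :: w) = 0 := by
  rw [wordCoord, if_neg (by tauto), selectIdx, dif_neg]
  rintro ⟨i, hi⟩
  have := hi.chain
  rw [Cycle.chain_coe_cons, List.cons_append, List.isChain_cons_cons] at this
  exact hpq this.1

/-- Replacing `xx` by `yx` removes one letter `x`, which changes the sign in `wordCoord`; if `z`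
occurs, both words have coordinate `0`. -/
lemma wordCoord_xx (w : List Gen) :
    wordCoord k (Gen.x :: Gen.x :: w) + wordCoord k (Gen.y :: Gen.x :: w) = 0 := by
  by_cases hz : Gen.z ∈ w
  · rw [wordCoord_of_not_admissible k (by simp [Admissible]) w (by simp [hz]),
      wordCoord_of_not_admissible k (by simp [Admissible]) w (by simp [hz]), add_zero]
  · rw [wordCoord, if_pos (by simp [hz]), wordCoord, if_pos (by simp [hz])]
    simp [pow_succ]

/-- The coordinates of words define a trace on `A`, that is, a linear map on `HH₀`. -/
lemma exists_coord :
    ∃ φ : KH0 k →ₗ[k] Idx0 →₀ k, ∀ w, φ (cls0 k (monomial k w)) = wordCoord k w := by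
  have hrot : ∀ p q u v, wordCoord k (u ++ [p, q] ++ v) = wordCoord k (p :: q :: (v ++ u)) := by
    intro p q u v
    rw [List.append_assoc, wordCoord_append_comm]
    simp
  obtain ⟨φ, hφ⟩ := exists_linearMap_of_words k (wordCoord k)
    (fun u v => by rw [hrot, hrot, wordCoord_xx])
    (fun u v => by
      rw [hrot]
      exact wordCoord_of_not_admissible k (by simp [Admissible]) _ (by simp))
    (fun u v => by
      rw [hrot]
      exact wordCoord_of_not_admissible k (by simp [Admissible]) _ (by simp))
  refine ⟨(LinearMap.range (kosD1 k)).liftQ φ ?_, hφ⟩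
  rw [LinearMap.range_le_ker_iff]
  ext1 c
  rw [LinearMap.comp_apply, LinearMap.zero_apply]
  induction c using K1_induction with
  | h0 => rw [map_zero, map_zero]
  | ha u v hu hv => rw [map_add, map_add, hu, hv, add_zero]
  | hs p a =>
    rw [kosD1_kos1]
    induction a using A_induction with
    | add a b ha hb =>
      have : (a + b) * gen k p - gen k p * (a + b)
          = (a * gen k p - gen k p * a) + (b * gen k p - gen k p * b) := by
        rw [add_mul, mul_add]; abel
      rw [this, map_add, ha, hb, add_zero]
    | smul r a ha => rw [smul_mul_assoc, mul_smul_comm, ← smul_sub, map_smul, ha, smul_zero]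
    | monomial w =>
      have h1 : monomial k w * gen k p = monomial k (w ++ [p]) := by simp
      rw [h1, ← monomial_cons, map_sub, hφ, hφ, wordCoord_append_comm]
      simp

lemma monomial_blockWord (L : List (ℕ+ × ℕ+)) : monomial k (blockWord L) = epsWord k L := by
  induction L with
  | nil => rfl
  | cons q L ih =>
    rw [blockWord_cons, monomial_append, ih]
    simp [epsWord, mul_assoc]

lemma linearIndependent_family0 : LinearIndependent k (family0 k) := by
  obtain ⟨φ, hφ⟩ := exists_coord k
  have hbeta : ∀ n, φ (cls0 k (y k ^ n * x k)) = Finsupp.single (betaIdx n) 1 := by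
    intro n
    have h : y k ^ n * x k = monomial k (List.replicate n Gen.y ++ [Gen.x]) := by simp
    rw [h, hφ, wordCoord, if_pos (by simp)]
    simp [List.count_replicate]
  apply LinearIndependent.of_comp φ
  have h : φ ∘ family0 k = fun i => Finsupp.single i 1 := by
    funext i
    cases i with
    | zeta => exact (hφ []).trans (wordCoord_of_represents k rfl)
    | alpha =>
      have := hbeta 0
      rwa [pow_zero, one_mul] at this
    | beta n =>
      have := hbeta n
      rwa [← PNat.natPred_add_one n, betaIdx, PNat.succPNat_natPred, PNat.natPred_add_one n] at this
    | gamma n =>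
      have := (hφ (List.replicate n Gen.y)).trans (wordCoord_of_represents k (i := .gamma n) rfl)
      rwa [monomial_replicate] at this
    | delta n =>
      have := (hφ (List.replicate n Gen.z)).trans (wordCoord_of_represents k (i := .delta n) rfl)
      rwa [monomial_replicate] at this
    | eps d hd =>
      induction d using Quotient.inductionOn with
      | h L =>
      have := (hφ (blockWord L)).trans (wordCoord_of_represents k
        (i := .eps (L : Cycle (ℕ+ × ℕ+)) hd) ⟨L, rfl, rfl⟩)
      rwa [monomial_blockWord] at this
  rw [h]
  exact Finsupp.linearIndependent_single_one k Idx0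

end Independence

/-! ### Connes' differential on the Koszul side -/

section Connes

variable (k : Type*) [Field k]

lemma kosD1_cycDeriv_one (w : List Gen) : kosD1 k (cycDeriv k w 1) = 0 := by
  rw [kosD1_cycDeriv, one_mul, mul_one, sub_self]

/-- Connes' differential sends the class of a word to the class of its cyclic derivative. -/
lemma comp1_cls1_cycDeriv (w : List Gen) :
    comp1 k (cls1 k (cycDeriv k w 1) (kosD1_cycDeriv_one k w))
      = connes k (A k) (comp0 k (cls0 k (monomial k w))) :=
  ((Submodule.Quotient.eq
    ((LinearMap.range (hochD2 k (A k))).submoduleOf (LinearMap.ker (hochD1 k (A k))))).2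
    (chain1_sub_incl1_cycDeriv k w 1)).symm

/-- Connes' differential on Koszul homology, transported along the comparison isomorphisms. -/
def koszulConnes : KH0 k →ₗ[k] KH1 k :=
  (LinearEquiv.ofBijective (comp1 k) (comp1_bijective k)).symm.toLinearMap
    ∘ₗ connes k (A k) ∘ₗ comp0 k

lemma comp1_koszulConnes (u : KH0 k) :
    comp1 k (koszulConnes k u) = connes k (A k) (comp0 k u) :=
  (LinearEquiv.ofBijective (comp1 k) (comp1_bijective k)).apply_symm_apply _

lemma koszulConnes_monomial (w : List Gen) :
    koszulConnes k (cls0 k (monomial k w))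
      = cls1 k (cycDeriv k w 1) (kosD1_cycDeriv_one k w) :=
  (comp1_bijective k).1 ((comp1_koszulConnes k _).trans (comp1_cls1_cycDeriv k w).symm)

lemma cls1_congr {c c' : K1 k} (h : c = c') (hc : kosD1 k c = 0) (hc' : kosD1 k c' = 0) :
    cls1 k c hc = cls1 k c' hc' := by
  subst h
  rfl

lemma smul_cls1 (r : k) (c : K1 k) (hc : kosD1 k c = 0) (hc' : kosD1 k (r • c) = 0) :
    r • cls1 k c hc = cls1 k (r • c) hc' := rfl

lemma cycDeriv_replicate (n : ℕ) (p : Gen) (a : A k) :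
    cycDeriv k (List.replicate n p) a
      = ∑ t ∈ Finset.Icc 1 n, kos1 k p (gen k p ^ (n - t) * a * gen k p ^ (t - 1)) := by
  induction n generalizing a with
  | zero => simp
  | succ n ih =>
    rw [List.replicate_succ, cycDeriv_cons, ih, ← Finset.Ico_add_one_right_eq_Icc,
      ← Finset.Ico_add_one_right_eq_Icc, Finset.sum_Ico_eq_sum_range,
      Finset.sum_Ico_eq_sum_range, Nat.add_sub_cancel, Nat.add_sub_cancel, Finset.sum_range_succ',
      add_comm]
    congr 1
    · refine Finset.sum_congr rfl fun t _ => ?_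
      have h1 : n + 1 - (1 + (t + 1)) = n - (1 + t) := by omega
      have h2 : 1 + (t + 1) - 1 = (1 + t - 1) + 1 := by omega
      rw [h1, h2, pow_succ']
      simp only [mul_assoc]
    · simp

lemma cycDeriv_replicate_one (n : ℕ) (p : Gen) :
    cycDeriv k (List.replicate n p) 1 = (n : k) • kos1 k p (gen k p ^ (n - 1)) := by
  rw [cycDeriv_replicate, Finset.sum_congr rfl (g := fun _ => kos1 k p (gen k p ^ (n - 1)))]
  · rw [Finset.sum_const, Nat.card_Icc, Nat.add_sub_cancel, Nat.cast_smul_eq_nsmul]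
  · intro t ht
    rw [Finset.mem_Icc] at ht
    rw [mul_one, ← pow_add]
    congr 2
    omega

lemma koszulConnes_gen_pow (n : ℕ) (p : Gen) (h : kosD1 k (kos1 k p (gen k p ^ (n - 1))) = 0) :
    koszulConnes k (cls0 k (gen k p ^ n)) = (n : k) • cls1 k (kos1 k p (gen k p ^ (n - 1))) h := by
  rw [← monomial_replicate, koszulConnes_monomial,
    smul_cls1 k _ _ _ (by rw [map_smul, h, smul_zero])]
  exact cls1_congr k (cycDeriv_replicate_one k n p) _ _

lemma x_pow_succ (n : ℕ) : x k ^ (n + 1) = (-1 : k) ^ n • (y k ^ n * x k) := by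
  induction n with
  | zero => simp
  | succ n ih =>
    rw [pow_succ' (x k), ih, mul_smul_comm, x_mul_pow_mul_x, pow_succ (-1 : k), mul_neg_one,
      neg_smul, smul_neg]

/-- Up to sign `yⁿ x` is the power `xⁿ⁺¹`, whose cyclic derivative is `(n + 1) xⁿ ⊗ x`. -/
lemma koszulConnes_beta0 (n : ℕ) :
    koszulConnes k (beta0 k (n + 1)) = -((n : k) + 2) • gamma1 k n := by
  have hsq : ∀ n : ℕ, (-1 : k) ^ n * (-1) ^ n = 1 := fun n => by
    rw [← mul_pow]; simp
  have h1 : beta0 k (n + 1) = (-1 : k) ^ (n + 1) • cls0 k (x k ^ (n + 1 + 1)) := by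
    rw [x_pow_succ]
    change _ = cls0 k ((-1 : k) ^ (n + 1) • (-1 : k) ^ (n + 1) • _)
    rw [smul_smul, hsq, one_smul]
    rfl
  have h2 : kosD1 k (kos1 k Gen.x (x k ^ (n + 1 + 1 - 1))) = 0 := by
    rw [kosD1_kos1, Nat.add_sub_cancel, ← pow_succ, ← pow_succ', sub_self]
  rw [h1, map_smul, koszulConnes_gen_pow k _ _ h2]
  have h3 : cls1 k (kos1 k Gen.x (x k ^ (n + 1 + 1 - 1))) h2 = (-1 : k) ^ n • gamma1 k n := by
    have hγ : kosD1 k ((-1 : k) ^ n • kos1 k Gen.x (y k ^ n * x k)) = 0 := by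
      rw [← map_smul, ← x_pow_succ, kosD1_kos1, ← pow_succ, ← pow_succ', sub_self]
    refine cls1_congr k ?_ _ hγ
    rw [Nat.add_sub_cancel, x_pow_succ, map_smul]
  rw [h3, smul_smul, smul_smul]
  congr 1
  push_cast
  rw [pow_succ]
  linear_combination (-(n : k) - 2) * hsq n

/-- The word `x y^{n₁} z^{m₁} ⋯ x y^{nₚ} z^{mₚ}`. -/
def xBlockWord (L : List (ℕ+ × ℕ+)) : List Gen :=
  L.flatMap fun q => Gen.x :: (List.replicate q.1 Gen.y ++ List.replicate q.2 Gen.z)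

lemma xBlockWord_cons (q : ℕ+ × ℕ+) (L : List (ℕ+ × ℕ+)) :
    xBlockWord (q :: L)
      = (Gen.x :: (List.replicate q.1 Gen.y ++ List.replicate q.2 Gen.z)) ++ xBlockWord L := rfl

lemma monomial_xBlockWord (L : List (ℕ+ × ℕ+)) : monomial k (xBlockWord L) = xWord k L := by
  induction L with
  | nil => rfl
  | cons q L ih =>
    rw [xBlockWord_cons, monomial_append, ih]
    simp [xWord, mul_assoc]

lemma x_mul_epsWord (L : List (ℕ+ × ℕ+)) : x k * epsWord k L = xWord k L * x k := by
  induction L with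
  | nil => simp [epsWord, xWord]
  | cons q L ih =>
    simp only [epsWord, xWord, List.map_cons, List.prod_cons, mul_assoc] at ih ⊢
    rw [ih]

lemma cls0_epsWord (L : List (ℕ+ × ℕ+)) : cls0 k (epsWord k L) = cls0 k (xWord k L) := by
  rcases List.eq_nil_or_concat' L with rfl | ⟨L, q, rfl⟩
  · rfl
  · have h1 : epsWord k (L ++ [q])
        = epsWord k L * y k ^ (q.1 : ℕ) * z k ^ (q.2 : ℕ) * x k := by
      simp [epsWord, mul_assoc]
    have h2 : xWord k (L ++ [q])
        = x k * (epsWord k L * y k ^ (q.1 : ℕ) * z k ^ (q.2 : ℕ)) := by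
      rw [mul_assoc, ← mul_assoc, x_mul_epsWord]
      simp [xWord, mul_assoc]
    rw [h1, h2, cls0_mul_comm]

/-- A summand of `θ₁` is the cyclic derivative of one block `x yⁿ zᵐ`. -/
lemma cycDeriv_block (q : ℕ+ × ℕ+) (r : List (ℕ+ × ℕ+)) :
    cycDeriv k (Gen.x :: (List.replicate q.1 Gen.y ++ List.replicate q.2 Gen.z)) (xWord k r)
      = thetaTerm k (q :: r) := by
  obtain ⟨n, m⟩ := q
  rw [cycDeriv_cons, cycDeriv_append, cycDeriv_replicate, cycDeriv_replicate, thetaTerm, add_assoc]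
  simp only [monomial_append, monomial_replicate, mul_assoc]

lemma xWord_append (L L' : List (ℕ+ × ℕ+)) : xWord k (L ++ L') = xWord k L * xWord k L' := by
  simp [xWord]

/-- The cyclic derivative of `x y^{n₁} z^{m₁} ⋯` is the sum of the contributions of its blocks. -/
lemma cycDeriv_xBlockWord (L R : List (ℕ+ × ℕ+)) :
    cycDeriv k (xBlockWord L) (xWord k R)
      = ∑ i ∈ Finset.range L.length, thetaTerm k (L.drop i ++ (R ++ L.take i)) := by
  induction L generalizing R with
  | nil => simp [xBlockWord]
  | cons q L ih =>
    have hq : xWord k R * monomial k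
        (Gen.x :: (List.replicate q.1 Gen.y ++ List.replicate q.2 Gen.z)) = xWord k (R ++ [q]) := by
      rw [xWord_append]
      simp [xWord, mul_assoc]
    rw [xBlockWord_cons, cycDeriv_append, hq, ih, monomial_xBlockWord, ← xWord_append,
      cycDeriv_block, List.length_cons, Finset.sum_range_succ', add_comm]
    simp

lemma cycDeriv_xBlockWord_one (L : List (ℕ+ × ℕ+)) :
    cycDeriv k (xBlockWord L) 1 = thetaChain k L := by
  have h := cycDeriv_xBlockWord k L []
  rw [thetaChain]
  refine h.trans (Finset.sum_congr rfl fun i hi => ?_)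
  rw [List.nil_append, List.rotate_eq_drop_append_take (Finset.mem_range.1 hi).le]

lemma koszulConnes_eps0 (L : List (ℕ+ × ℕ+)) :
    koszulConnes k (eps0 k (L : Cycle (ℕ+ × ℕ+))) = theta1 k L := by
  change koszulConnes k (cls0 k (epsWord k L)) = _
  rw [cls0_epsWord, ← monomial_xBlockWord, koszulConnes_monomial]
  exact cls1_congr k (cycDeriv_xBlockWord_one k L) _ _

end Connes

end HochConnes

end

theorem mainTheorem10 (k : Type*) [Field k] [CharZero k] :
    (LinearIndependent k (HochConnes.family0 k) ∧
      Submodule.span k (Set.range (HochConnes.family0 k)) = ⊤) ∧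
    Function.Bijective (HochConnes.comp0 k) ∧
    Function.Bijective (HochConnes.comp1 k) ∧
    ∃ b₀ : HochConnes.KH0 k →ₗ[k] HochConnes.KH1 k,
      (∀ u : HochConnes.KH0 k, HochConnes.comp1 k (b₀ u) =
        HochConnes.connes k (HochConnes.A k) (HochConnes.comp0 k u)) ∧
      b₀ (HochConnes.alpha0 k) = HochConnes.alpha1 k ∧
      (∀ n : ℕ, 2 ≤ n → b₀ (HochConnes.beta0 k n) =
        -((n : k) + 1) • HochConnes.gamma1 k (n - 1)) ∧
      b₀ (HochConnes.beta0 k 1) = (-2 : k) • HochConnes.beta1 k ∧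
      (∀ n : ℕ, 2 ≤ n → b₀ (HochConnes.gamma0 k n) = (n : k) • HochConnes.eps1 k (n - 1)) ∧
      b₀ (HochConnes.gamma0 k 1) = HochConnes.delta1 k ∧
      (∀ m : ℕ, 2 ≤ m → b₀ (HochConnes.delta0 k m) = (m : k) • HochConnes.eta1 k (m - 1)) ∧
      b₀ (HochConnes.delta0 k 1) = HochConnes.zeta1 k ∧
      (∀ L : List (ℕ+ × ℕ+), L ≠ [] →
        b₀ (HochConnes.eps0 k (L : Cycle (ℕ+ × ℕ+))) = HochConnes.theta1 k L) ∧
      b₀ (HochConnes.zeta0 k) = 0 := by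
  open HochConnes in
  have hgen : ∀ p : Gen, ∀ h, koszulConnes k (cls0 k (gen k p)) = cls1 k (kos1 k p 1) h := by
    intro p h
    have h1 := koszulConnes_monomial k [p]
    rw [monomial_cons, monomial_nil, mul_one] at h1
    rw [h1]
    exact cls1_congr k (by simp [cycDeriv_cons]) _ _
  refine ⟨⟨linearIndependent_family0 k, span_family0 k⟩, comp0_bijective k, comp1_bijective k,
    koszulConnes k, comp1_koszulConnes k, hgen _ _, ?_, ?_, ?_, ?_, ?_, ?_, ?_, ?_⟩
  · intro n hn
    obtain ⟨n, rfl⟩ : ∃ m, n = m + 1 := ⟨n - 1, by omega⟩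
    rw [koszulConnes_beta0, Nat.add_sub_cancel]
    congr 1
    push_cast
    ring
  · rw [koszulConnes_beta0 k 0]
    congr 1
    · simp
    · exact cls1_congr k (by simp) _ _
  · intro n _
    exact koszulConnes_gen_pow k n Gen.y _
  · rw [gamma0, pow_one]
    exact hgen Gen.y _
  · intro n _
    exact koszulConnes_gen_pow k n Gen.z _
  · rw [delta0, pow_one]
    exact hgen Gen.z _
  · intro L _
    exact koszulConnes_eps0 k L
  · have h := koszulConnes_monomial k []
    exact h
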